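/- Let $\mu$ be a finite measure on $\mathbb N=\{0,1,2,\dots\}$ with $\mu(1)=0$ and $\mu(0)>0$. Consider the continuous-time Bienaymé–Galton–Watson process $Z=(Z_t)_{t\ge 0}$, with its genealogy, started from $x\in\mathbb N$ individuals at time $0$ (law $\mathbb P_x$): each individual lives for an exponential time with parameter $\mu(\mathbb N)$ and is then replaced by a random number of children with law $\mu(\mathbb N)^{-1}\mu$, all lifetimes and numbers of children being independent. Put $\psi_t(s)=\mathbb E_1(s^{Z_t})$, with derivatives $\psi_t',\psi_t''$ in $s$, and $\Phi(s)=\sum_{n\ge 0}(s^n-s)\mu(n)$ for $s\in[0,1]$. (If infinitely many individuals are extant at time $t$, then $Z_t=\infty$ and $s^{Z_t}$ is read as $0$.) If $2\le Z_t<\infty$, pick uniformly, without replacement, two of the individuals $\sigma_1,\sigma_2$ extant at time $t$, and let $$T=\inf\{u: 0<u\le t,\ \sigma_1 \text{ and } \sigma_2 \text{ have the same ancestor at time } t-u\},\qquad \inf\emptyset=\infty$$ (an individual extant at time $t-u$ counts as its own ancestor at that time). Otherwise put $T=\infty$. Write $\mathbb P_x^{(t)}$ for the joint law of the genealogy started from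 $x$ individuals and of the pair picked at time $t$. Here, for all $x\in\mathbb N$, $t\ge0$ and $s\in[0,1]$, one has $\mathbb E_x(s^{Z_t})=\psi_t(s)^x$, with $\partial_t\psi_t(s)=\Phi(\psi_t(s))$ and $\psi_0(s)=s$. Moreover: 1. For all $x\in\mathbb N$ and $0<t_1\le t$, $$\mathbb P_x^{(t)}(T\le t_1)=x\int_0^1(1-s)\,\frac{\psi_{t_1}''(s)}{\psi_{t_1}'(s)}\,\psi_t'(s)\,\psi_t(s)^{x-1}\,ds .$$ 2. For all $x\in\mathbb N$ and $t>0$, the probability under $\mathbb P_x^{(t)}$ that at least two (and finitely many) individuals are extant at time $t$ and that the picked pair has no common ancestor, i.e. $2\le Z_t<\infty$ and $T=\infty$, equals $$x(x-1)\int_0^1(1-s)\,\psi_t'(s)^2\,\psi_t(s)^{x-2}\,ds .$$ The integrals converge. (For $x=0$ in 1, and for $x\le1$ in 2, the right-hand side is read as $0$.) -/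

import Mathlib

open MeasureTheory ProbabilityTheory Set
open scoped ENNReal

noncomputable section

namespace BGW

/-- Labels of potential individuals, when there are `x` founders: `(i, [k₁, …, kₙ])` is the
`kₙ`-th child of … of the `k₁`-th child of founder number `i` (children are numbered from `0`). -/
abbrev Ind (x : ℕ) : Type := Fin x × List ℕ

/-- A realization: to each label are attached a lifetime and a number of offspring. -/
abbrev Tree (x : ℕ) : Type := Ind x → ℝ × ℕ

/-- Law of the pair (lifetime, number of offspring) of an individual: the lifetime is exponential
with parameter `μ(ℕ)`, and the number of offspring is independent of it with law `μ(ℕ)⁻¹ μ`. -/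
def vecLaw (μ : Measure ℕ) : Measure (ℝ × ℕ) :=
  (expMeasure (μ.real univ)).prod ((μ univ)⁻¹ • μ)

instance (μ : Measure ℕ) [IsFiniteMeasure μ] [NeZero μ] : IsProbabilityMeasure (vecLaw μ) := by
  have h : 0 < μ.real univ := measureReal_univ_pos
  have := isProbabilityMeasure_expMeasure h
  unfold vecLaw
  infer_instance

/-- The law `ℙ_x` of the genealogy started from `x` individuals: the random vectors attached to
the individuals are i.i.d. -/
def law (μ : Measure ℕ) [IsFiniteMeasure μ] [NeZero μ] (x : ℕ) : Measure (Tree x) :=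
  Measure.infinitePi (fun _ : Ind x => vecLaw μ)

variable {x : ℕ}

/-- The individual `a` is really born at some time: each of its ancestors has enough children. -/
def Exists (ω : Tree x) (a : Ind x) : Prop :=
  ∀ (v : List ℕ) (k : ℕ), (v ++ [k]) <+: a.2 → k < (ω (a.1, v)).2

/-- Birth time: the sum of the lifetimes of the strict ancestors. -/
def birth (ω : Tree x) (a : Ind x) : ℝ :=
  ∑ k ∈ Finset.range a.2.length, (ω (a.1, a.2.take k)).1

/-- Death time: birth time plus lifetime. -/
def death (ω : Tree x) (a : Ind x) : ℝ := birth ω a + (ω a).1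

/-- The individuals extant at time `t`. -/
def alive (ω : Tree x) (t : ℝ) : Set (Ind x) :=
  {a | Exists ω a ∧ birth ω a ≤ t ∧ t < death ω a}

/-- The population size `Z_t` (it is `⊤` if infinitely many individuals are extant). -/
def Z (t : ℝ) (ω : Tree x) : ℕ∞ := (alive ω t).encard

/-- `𝔼_x(s^{Z_t})`, with the convention `s^∞ = 0`. -/
def genFun (μ : Measure ℕ) [IsFiniteMeasure μ] [NeZero μ] (x : ℕ) (t s : ℝ) : ℝ :=
  ∫ ω in {ω : Tree x | Z t ω < ⊤}, s ^ (Z t ω).toNat ∂(law μ x)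

/-- `ψ_t(s) = 𝔼_1(s^{Z_t})`. -/
def psi (μ : Measure ℕ) [IsFiniteMeasure μ] [NeZero μ] (t s : ℝ) : ℝ := genFun μ 1 t s

/-- `Φ(s) = ∑ₙ (sⁿ - s) μ(n)`. -/
def Phi (μ : Measure ℕ) (s : ℝ) : ℝ := ∑' n : ℕ, (s ^ n - s) * μ.real {n}

/-- `v` is `a` or an ancestor of `a`. -/
def IsAncestor (v a : Ind x) : Prop := v.1 = a.1 ∧ v.2 <+: a.2

/-- `a` and `b` have the same ancestor at time `r`. (The individual extant at time `r` which is
an ancestor of a given individual extant at a time `t ≥ r` is unique.) -/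
def CommonAncestorAt (ω : Tree x) (r : ℝ) (a b : Ind x) : Prop :=
  ∃ v ∈ alive ω r, IsAncestor v a ∧ IsAncestor v b

/-- The coalescence time `inf {u : 0 < u ≤ t, τ_u(a) = τ_u(b)}`, with `inf ∅ = ∞`. -/
def pairCoalTime (t : ℝ) (ω : Tree x) (a b : Ind x) : EReal :=
  sInf ((fun u : ℝ => (u : EReal)) '' {u | 0 < u ∧ u ≤ t ∧ CommonAncestorAt ω (t - u) a b})

open Classical in
/-- Given the genealogy, the law of the pair picked at time `t`: uniform among the ordered pairs
of distinct extant individuals; no pair (`none`) is picked if there are less than two extant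
individuals (or infinitely many, where there is no uniform pick). -/
def pickLaw (t : ℝ) (ω : Tree x) : PMF (Option (Ind x × Ind x)) :=
  if h : (alive ω t).offDiag.Finite ∧ (alive ω t).offDiag.Nonempty then
    (PMF.uniformOfFinset h.1.toFinset (h.1.toFinset_nonempty.2 h.2)).map some
  else PMF.pure none

/-- The coalescence time `T` of the picked pair; it is `∞` if no pair is picked. -/
def T (t : ℝ) (ω : Tree x) : Option (Ind x × Ind x) → EReal
  | some p => pairCoalTime t ω p.1 p.2
  | none => ⊤

/-- `ℙ_x^{(t)}(E)` for an event `E` that depends on the genealogy and on the pair picked at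
time `t`: the mean under `ℙ_x` of the conditional probability of `E` given the genealogy. -/
def prob (μ : Measure ℕ) [IsFiniteMeasure μ] [NeZero μ] (x : ℕ) (t : ℝ)
    (E : Set (Tree x × Option (Ind x × Ind x))) : ℝ≥0∞ :=
  ∫⁻ ω, (pickLaw t ω).toOuterMeasure {c | (ω, c) ∈ E} ∂(law μ x)

end BGW

end

/-! A uniform choice is turned into a generating function. If `z ≥ 2` individuals are extant, of
which `N` ordered pairs are favourable, the picked pair is favourable with probability `N /
(z(z-1))`, and `1 / (z(z-1)) = ∫₀¹ (1-s) s^(z-2) ds`. By Tonelli the probability sought is `∫₀¹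
(1-s) s⁻² 𝔼_x(N s^Z) ds` (`toOuterMeasure_pickLaw`, `prob_eq`). It remains to compute `𝔼_x(N s^Z)`
for `0 < s < 1`. The convention `s^∞ = 0` disposes of explosion, and powers of `Z` times `s^Z` are
bounded, so no moment of `Z` is needed.

Write `c = μ(ℕ)`. For the coalescence time, `N` counts the pairs extant at `t` with a common
ancestor at time `t - b`, where `b = t₁`. Almost surely this is the event `T ≤ b`
(`pairCoalTime_le_iff`, `ae_birth_ne`). Since `N` is a sum over the founders and `s^Z` a product,
independence of the founders leaves `m(t) = 𝔼_1(N s^{Z_t})`. Decomposing at the death of the founder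
(`lintegral_law_one`) gives, for `t ≥ b`, a renewal equation saying that `e^{ct} m(t)` solves `y' =
(∑ k μ(k) ψ_t(s)^(k-1)) y` with initial value `e^{cb} 𝔼_1(Z_b(Z_b-1)s^{Z_b})` at time `b`. The
function `e^{ct} 𝔼_1(Z_t s^{Z_t}) = e^{ct} s ψ_t'(s)` solves the same linear equation, so the
quotient of the two does not depend on `t`. Its value at `t = b` gives `m(t) = s² ψ_b''(s) ψ_t'(s) /
ψ_b'(s)` (`meanPairs_mul_meanZ`). The Markov property at the fixed time `t - b` is never used.

For pairs without a common ancestor, `N` counts pairs with distinct founders, and independence gives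
`x(x-1) ψ_t^(x-2) (s ψ_t')²` (`lintegral_foreignPairs`). The power formula for `𝔼_x(s^Z)` is
independence again, and the equation `∂ψ = Φ(ψ)` is the differentiated renewal equation of `ψ`. -/

namespace BGW

/-! ### Branching structure of a fixed realization: splitting by founders and at the root -/

section

variable {x : ℕ}

/-- The root of a tree with one founder. -/
def root : Ind 1 := (0, [])

/-- The tree of the descendants of the founder `i`. -/
def comp (ω : Tree x) (i : Fin x) : Tree 1 := fun a => ω (i, a.2)

/-- The label, in the whole population, of a descendant of the founder `i`. -/
def inj (i : Fin x) (a : Ind 1) : Ind x := (i, a.2)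

/-- The forest whose founders are the first `k` children of the root. -/
def children (τ : Tree 1) (k : ℕ) : Tree k := fun a => τ (0, (a.1 : ℕ) :: a.2)

/-- The label, in the whole tree, of an individual of the forest `children τ k`. -/
def graft {k : ℕ} (a : Ind k) : Ind 1 := (0, (a.1 : ℕ) :: a.2)

/-- All lifetimes are positive. -/
def Good (ω : Tree x) : Prop := ∀ a, 0 < (ω a).1

/-- The ordered pairs of distinct individuals extant at time `t` with a common ancestor at
time `r`. -/
def pairs (r t : ℝ) (ω : Tree x) : Set (Ind x × Ind x) :=
  {p | p ∈ (alive ω t).offDiag ∧ CommonAncestorAt ω r p.1 p.2}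

lemma inj_injective (i : Fin x) : Function.Injective (inj i) := by
  rintro ⟨a, v⟩ ⟨b, w⟩ h
  simp only [inj, Prod.mk.injEq, true_and] at h
  exact Prod.ext (Subsingleton.elim _ _) h

lemma graft_injective {k : ℕ} : Function.Injective (graft (k := k)) := by
  rintro ⟨a, v⟩ ⟨b, w⟩ h
  simp only [graft, Prod.mk.injEq, List.cons.injEq, true_and] at h
  exact Prod.ext (Fin.ext h.1) h.2

lemma inj_mem_alive (ω : Tree x) (i : Fin x) (t : ℝ) (a : Ind 1) :
    inj i a ∈ alive ω t ↔ a ∈ alive (comp ω i) t := by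
  obtain ⟨j, v⟩ := a
  obtain rfl := Subsingleton.elim j 0
  rfl

lemma Good.comp {ω : Tree x} (h : Good ω) (i : Fin x) : Good (comp ω i) := fun _ => h _

lemma Good.children {τ : Tree 1} (h : Good τ) (k : ℕ) : Good (children τ k) := fun _ => h _

lemma exists_graft (τ : Tree 1) (a : Ind (τ root).2) :
    Exists τ (graft a) ↔ Exists (children τ (τ root).2) a := by
  constructor
  · intro h v k hk
    refine h ((a.1 : ℕ) :: v) k ?_
    simpa [graft] using hk
  · intro h v k hk
    rcases v with _ | ⟨j, v⟩
    · simp only [graft, List.nil_append, List.cons_prefix_cons, List.nil_prefix, and_true] at hk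
      rw [hk]
      exact a.1.2
    · simp only [graft, List.cons_append, List.cons_prefix_cons] at hk
      rw [hk.1]
      exact h v k hk.2

lemma birth_graft {k : ℕ} (τ : Tree 1) (a : Ind k) :
    birth τ (graft a) = (τ root).1 + birth (children τ k) a := by
  simp only [birth, graft, List.length_cons]
  rw [Finset.sum_range_succ', add_comm]
  simp [root, children]

lemma death_graft {k : ℕ} (τ : Tree 1) (a : Ind k) :
    death τ (graft a) = (τ root).1 + death (children τ k) a := by
  rw [death, birth_graft, death, add_assoc]
  rfl

lemma Good.birth_nonneg {ω : Tree x} (h : Good ω) (a : Ind x) : 0 ≤ birth ω a :=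
  Finset.sum_nonneg fun _ _ => (h _).le

lemma birth_root (τ : Tree 1) : birth τ root = 0 := by simp [birth, root]

lemma death_root (τ : Tree 1) : death τ root = (τ root).1 := by simp [death, birth_root]

lemma exists_of_snd_eq_nil (ω : Tree x) (i : Fin x) : Exists ω (i, []) := by
  intro v k h
  simp at h

lemma eq_root_or_graft {τ : Tree 1} {a : Ind 1} (h : Exists τ a) :
    a = root ∨ ∃ b : Ind (τ root).2, a = graft b := by
  obtain ⟨j, v⟩ := a
  obtain rfl := Subsingleton.elim j 0
  rcases v with _ | ⟨i, v⟩
  · exact Or.inl rfl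
  · have hi : i < (τ root).2 := h [] i (by simp)
    exact Or.inr ⟨(⟨i, hi⟩, v), rfl⟩

lemma root_mem_alive {τ : Tree 1} {t : ℝ} : root ∈ alive τ t ↔ 0 ≤ t ∧ t < (τ root).1 := by
  simp only [alive, mem_ofPred_eq, birth_root, death_root]
  exact and_iff_right (exists_of_snd_eq_nil τ 0)

lemma graft_mem_alive {τ : Tree 1} {t : ℝ} (a : Ind (τ root).2) :
    graft a ∈ alive τ t ↔ a ∈ alive (children τ (τ root).2) (t - (τ root).1) := by
  simp only [alive, mem_ofPred_eq, birth_graft, death_graft, exists_graft]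
  refine and_congr_right fun _ => and_congr ?_ ?_ <;> constructor <;> intro <;> linarith

lemma Good.alive_of_lt {τ : Tree 1} (h : Good τ) {t : ℝ} (ht : 0 ≤ t) (hL : t < (τ root).1) :
    alive τ t = {root} := by
  ext a
  rw [mem_singleton_iff]
  constructor
  · intro ha
    rcases eq_root_or_graft ha.1 with rfl | ⟨b, rfl⟩
    · rfl
    · have h1 := ha.2.1
      rw [birth_graft] at h1
      have := (h.children (τ root).2).birth_nonneg b
      linarith
  · rintro rfl
    exact root_mem_alive.2 ⟨ht, hL⟩

/-- Once the root is dead, everyone extant belongs to the forest of its children, whose clock starts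
at the root's death. Positivity of lifetimes is not involved here, unlike in `Good.alive_of_lt`. -/
lemma alive_of_le {τ : Tree 1} {t : ℝ} (hL : (τ root).1 ≤ t) :
    alive τ t = graft '' alive (children τ (τ root).2) (t - (τ root).1) := by
  ext a
  constructor
  · intro ha
    rcases eq_root_or_graft ha.1 with rfl | ⟨b, rfl⟩
    · exact absurd (root_mem_alive.1 ha).2 hL.not_gt
    · exact ⟨b, (graft_mem_alive b).1 ha, rfl⟩
  · rintro ⟨b, hb, rfl⟩
    exact (graft_mem_alive b).2 hb

lemma isAncestor_graft {k : ℕ} (v a : Ind k) :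
    IsAncestor (graft v) (graft a) ↔ IsAncestor v a := by
  simp [IsAncestor, graft, List.cons_prefix_cons, Fin.ext_iff]

lemma commonAncestorAt_graft {τ : Tree 1} {r : ℝ} (hL : (τ root).1 ≤ r)
    (a b : Ind (τ root).2) :
    CommonAncestorAt τ r (graft a) (graft b) ↔
      CommonAncestorAt (children τ (τ root).2) (r - (τ root).1) a b := by
  unfold CommonAncestorAt
  rw [alive_of_le hL]
  simp only [exists_mem_image, isAncestor_graft]

lemma pairs_of_le {τ : Tree 1} {r t : ℝ} (hL : (τ root).1 ≤ r) (hrt : r ≤ t) :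
    pairs r t τ = Prod.map graft graft ''
      pairs (r - (τ root).1) (t - (τ root).1) (children τ (τ root).2) := by
  ext ⟨a, b⟩
  simp only [pairs, alive_of_le (hL.trans hrt), mem_ofPred_eq, mem_offDiag]
  constructor
  · rintro ⟨⟨⟨a, ha, rfl⟩, ⟨b, hb, rfl⟩, hab⟩, hc⟩
    exact ⟨(a, b), ⟨⟨ha, hb, fun h => hab (congrArg graft h)⟩, (commonAncestorAt_graft hL a b).1 hc⟩, rfl⟩
  · rintro ⟨⟨a', b'⟩, ⟨⟨ha, hb, hab⟩, hc⟩, h⟩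
    obtain ⟨rfl, rfl⟩ := Prod.mk.inj h
    exact ⟨⟨⟨a', ha, rfl⟩, ⟨b', hb, rfl⟩, graft_injective.ne hab⟩,
      (commonAncestorAt_graft hL a' b').2 hc⟩

lemma isAncestor_root (a : Ind 1) : IsAncestor root a :=
  ⟨Subsingleton.elim _ _, List.nil_prefix⟩

/-- A root still living at time `r` is a common ancestor of every pair. This produces the initial
value in the renewal equation for pairs. -/
lemma pairs_of_lt {τ : Tree 1} {r t : ℝ} (hr : 0 ≤ r) (hL : r < (τ root).1) :
    pairs r t τ = (alive τ t).offDiag := by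
  ext p
  refine and_iff_left ⟨root, root_mem_alive.2 ⟨hr, hL⟩, isAncestor_root _, isAncestor_root _⟩

lemma encard_eq_sum_fiber {β : Type*} (S : Set β) (f : β → Fin x) :
    S.encard = ∑ i, (S ∩ f ⁻¹' {i}).encard := by
  classical
  suffices h : ∀ I : Finset (Fin x), (S ∩ f ⁻¹' I).encard = ∑ i ∈ I, (S ∩ f ⁻¹' {i}).encard by
    have := h Finset.univ
    simpa using this
  intro I
  induction I using Finset.induction_on with
  | empty => simp
  | insert i I hi ih =>
    rw [Finset.sum_insert hi, ← ih, ← encard_union_eq]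
    · congr 1
      ext b
      simp only [Finset.coe_insert, mem_inter_iff, mem_preimage, mem_insert_iff, mem_union,
        mem_singleton_iff, Finset.mem_coe]
      tauto
    · rw [Set.disjoint_left]
      rintro b ⟨-, hb⟩ ⟨-, hb'⟩
      rw [mem_preimage, mem_singleton_iff] at hb
      rw [mem_preimage, hb] at hb'
      exact hi hb'

lemma alive_inter_fiber (ω : Tree x) (t : ℝ) (i : Fin x) :
    alive ω t ∩ Prod.fst ⁻¹' {i} = inj i '' alive (comp ω i) t := by
  ext ⟨j, v⟩
  constructor
  · rintro ⟨h, rfl⟩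
    exact ⟨(0, v), h, rfl⟩
  · rintro ⟨a, ha, h⟩
    rw [← h]
    exact ⟨(inj_mem_alive ω i t a).2 ha, rfl⟩

lemma Z_eq_sum (ω : Tree x) (t : ℝ) : Z t ω = ∑ i, Z t (comp ω i) := by
  rw [Z, encard_eq_sum_fiber _ Prod.fst]
  refine Finset.sum_congr rfl fun i _ => ?_
  rw [alive_inter_fiber, (inj_injective i).encard_image]
  rfl

lemma isAncestor_inj (i : Fin x) (v a : Ind 1) : IsAncestor (inj i v) (inj i a) ↔ IsAncestor v a := by
  simp [IsAncestor, inj, Subsingleton.elim v.1 a.1]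

lemma commonAncestorAt_inj (ω : Tree x) (i : Fin x) (r : ℝ) (a b : Ind 1) :
    CommonAncestorAt ω r (inj i a) (inj i b) ↔ CommonAncestorAt (comp ω i) r a b := by
  constructor
  · rintro ⟨⟨j, v⟩, hv, hva, hvb⟩
    obtain rfl : j = i := hva.1
    exact ⟨(0, v), hv, (isAncestor_inj j (0, v) a).1 hva, (isAncestor_inj j (0, v) b).1 hvb⟩
  · rintro ⟨v, hv, hva, hvb⟩
    exact ⟨inj i v, (inj_mem_alive ω i r v).2 hv, (isAncestor_inj i v a).2 hva,
      (isAncestor_inj i v b).2 hvb⟩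

lemma CommonAncestorAt.fst_eq {ω : Tree x} {r : ℝ} {a b : Ind x}
    (h : CommonAncestorAt ω r a b) : a.1 = b.1 := by
  obtain ⟨v, -, h1, h2⟩ := h
  exact h1.1.symm.trans h2.1

lemma pairs_inter_fiber (ω : Tree x) (r t : ℝ) (i : Fin x) :
    pairs r t ω ∩ (fun p => p.1.1) ⁻¹' {i} =
      Prod.map (inj i) (inj i) '' pairs r t (comp ω i) := by
  ext ⟨⟨j, v⟩, ⟨j', w⟩⟩
  constructor
  · rintro ⟨⟨⟨h1, h2, h3⟩, h⟩, hi⟩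
    obtain rfl : j = i := hi
    obtain rfl : j = j' := h.fst_eq
    refine ⟨((0, v), (0, w)), ⟨⟨h1, h2, ?_⟩, (commonAncestorAt_inj ω j r (0, v) (0, w)).1 h⟩, rfl⟩
    intro h4
    refine h3 ?_
    simpa using h4
  · rintro ⟨⟨a, b⟩, ⟨⟨h1, h2, h3⟩, h⟩, h4⟩
    rw [← h4]
    exact ⟨⟨⟨(inj_mem_alive ω i t a).2 h1, (inj_mem_alive ω i t b).2 h2,
      (inj_injective i).ne h3⟩, (commonAncestorAt_inj ω i r a b).2 h⟩, rfl⟩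

/-- Individuals with a common ancestor share their founder, so the count is additive over founders,
as the population size is. -/
lemma encard_pairs_eq_sum (ω : Tree x) (r t : ℝ) :
    (pairs r t ω).encard = ∑ i, (pairs r t (comp ω i)).encard := by
  rw [encard_eq_sum_fiber _ (fun p => p.1.1)]
  refine Finset.sum_congr rfl fun i _ => ?_
  rw [pairs_inter_fiber, ((inj_injective i).prodMap (inj_injective i)).encard_image]

lemma Good.Z_of_lt {τ : Tree 1} (h : Good τ) {t : ℝ} (ht : 0 ≤ t) (hL : t < (τ root).1) :
    Z t τ = 1 := by
  rw [Z, h.alive_of_lt ht hL, encard_singleton]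

lemma Z_of_le {τ : Tree 1} {t : ℝ} (hL : (τ root).1 ≤ t) :
    Z t τ = Z (t - (τ root).1) (children τ (τ root).2) := by
  rw [Z, alive_of_le hL, graft_injective.encard_image]
  rfl

lemma encard_pairs_of_le {τ : Tree 1} {r t : ℝ} (hL : (τ root).1 ≤ r) (hrt : r ≤ t) :
    (pairs r t τ).encard =
      (pairs (r - (τ root).1) (t - (τ root).1) (children τ (τ root).2)).encard := by
  rw [pairs_of_le hL hrt, (graft_injective.prodMap graft_injective).encard_image]

/-- The number of ordered pairs of distinct elements of a set of `z` elements. -/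
def numPairs (z : ℕ∞) : ℕ∞ := z * (z - 1)

lemma encard_offDiag {β : Type*} {S : Set β} (hS : S.Finite) :
    S.offDiag.encard = numPairs S.encard := by
  classical
  lift S to Finset β using hS
  rw [← Finset.coe_offDiag, encard_coe_eq_coe_finsetCard, encard_coe_eq_coe_finsetCard,
    Finset.offDiag_card, numPairs]
  rw [show (S.card * S.card - S.card : ℕ) = S.card * (S.card - 1) by rw [Nat.mul_sub, mul_one]]
  push_cast
  rfl

end

/-! ### Ancestral lines and the events expressed by the coalescence time -/

section

variable {x : ℕ}

lemma birth_take (ω : Tree x) (i : Fin x) (l : List ℕ) {n : ℕ} (hn : n ≤ l.length) :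
    birth ω (i, l.take n) = ∑ k ∈ Finset.range n, (ω (i, l.take k)).1 := by
  simp only [birth, List.length_take, min_eq_left hn]
  refine Finset.sum_congr rfl fun k hk => ?_
  rw [List.take_take, min_eq_left (Finset.mem_range.1 hk).le]

lemma birth_take_succ (ω : Tree x) (i : Fin x) (l : List ℕ) {n : ℕ} (hn : n < l.length) :
    birth ω (i, l.take (n + 1)) = death ω (i, l.take n) := by
  rw [death, birth_take ω i l hn, birth_take ω i l hn.le, Finset.sum_range_succ]

lemma Good.death_le_birth {ω : Tree x} (h : Good ω) {v w : Ind x} (hvw : IsAncestor v w)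
    (hne : v ≠ w) : death ω v ≤ birth ω w := by
  obtain ⟨i, l⟩ := w
  obtain ⟨j, v⟩ := v
  obtain ⟨rfl, hp⟩ := hvw
  simp only at hp hne
  have hlen : v.length < l.length := by
    refine lt_of_le_of_ne hp.length_le fun hl => hne ?_
    rw [hp.eq_of_length hl]
  have hv : v = l.take v.length := List.prefix_iff_eq_take.1 hp
  rw [hv, ← birth_take_succ ω j l hlen]
  rw [birth_take ω j l hlen]
  exact Finset.sum_le_sum_of_subset_of_nonneg (Finset.range_subset_range.2 hlen)
    fun _ _ _ => (h _).le

lemma Exists.of_isAncestor {ω : Tree x} {v a : Ind x} (ha : Exists ω a) (h : IsAncestor v a) :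
    Exists ω v := by
  obtain ⟨i, l⟩ := v
  obtain ⟨j, m⟩ := a
  obtain ⟨rfl, hp⟩ := h
  exact fun w k hk => ha w k (hk.trans hp)

/-- Take the last individual on the ancestral line of `a` born by time `r`. Either it is `a` itself,
or the next one on the line is born, at its death, after `r`. -/
lemma exists_ancestor_alive {ω : Tree x} {r t : ℝ} (hr : 0 ≤ r) (hrt : r ≤ t) {a : Ind x}
    (ha : a ∈ alive ω t) : ∃ v ∈ alive ω r, IsAncestor v a := by
  obtain ⟨i, l⟩ := a
  classical
  set m := Nat.findGreatest (fun n => birth ω (i, l.take n) ≤ r) l.length with hm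
  have h0 : birth ω (i, l.take m) ≤ r := by
    refine Nat.findGreatest_spec (P := fun n => birth ω (i, l.take n) ≤ r) (Nat.zero_le _) ?_
    simpa [birth] using hr
  have hanc : IsAncestor (i, l.take m) (i, l) := ⟨rfl, List.take_prefix _ _⟩
  refine ⟨(i, l.take m), ⟨Exists.of_isAncestor ha.1 hanc, h0, ?_⟩, hanc⟩
  rcases (Nat.findGreatest_le (P := fun n => birth ω (i, l.take n) ≤ r) l.length).eq_or_lt
    with h | h
  · rw [← hm] at h
    rw [h, List.take_length]
    exact hrt.trans_lt ha.2.2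
  · rw [← hm] at h
    rw [← birth_take_succ ω i l h]
    exact not_le.1 (Nat.findGreatest_is_greatest (P := fun n => birth ω (i, l.take n) ≤ r)
      (Nat.lt_succ_self m) h)

/-- Lives are the intervals `[birth, death)`, so the infimum defining the coalescence time need not
be attained: the equivalence can fail if a birth occurs exactly at `t - t₁`. Hypothesis `hb`
excludes this; founders are exempt because they are born at `0`, which is `t - t₁` when `t₁ = t`. -/
lemma pairCoalTime_le_iff {ω : Tree x} (h : Good ω) {t₁ t : ℝ} (h0 : 0 < t₁) (h1 : t₁ ≤ t)
    (hb : ∀ v : Ind x, v.2 ≠ [] → birth ω v ≠ t - t₁) {a b : Ind x} (ha : a ∈ alive ω t) :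
    pairCoalTime t ω a b ≤ (t₁ : EReal) ↔ CommonAncestorAt ω (t - t₁) a b := by
  constructor
  · intro hT
    obtain ⟨w, hw, hwa⟩ := exists_ancestor_alive (sub_nonneg.2 h1) (by linarith) ha
    -- `w` is the ancestor of `a` at time `t - t₁`. A common ancestor `v` living at a time when `w`
    -- is already born cannot be a strict ancestor of `w`, which would be dead by then. Hence `w` is
    -- an ancestor of `v`, or `v` itself, and so an ancestor of `b`.
    have key : ∃ u : ℝ, birth ω w ≤ t - u ∧ CommonAncestorAt ω (t - u) a b := by
      by_cases hnil : w.2 = []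
      · have hw0 : birth ω w = 0 := by simp [birth, hnil]
        obtain ⟨_, ⟨u, hu, rfl⟩, -⟩ := sInf_lt_iff.1 (hT.trans_lt (EReal.coe_lt_top t₁))
        exact ⟨u, by rw [hw0]; linarith [hu.2.1], hu.2.2⟩
      -- The strict inequality leaves room for some `u < t - birth ω w` in the set whose infimum is
      -- at most `t₁`.
      · have hlt : birth ω w < t - t₁ := lt_of_le_of_ne hw.2.1 (hb w hnil)
        have hlt' : (t₁ : EReal) < ((t - birth ω w : ℝ) : EReal) :=
          EReal.coe_lt_coe_iff.2 (by linarith)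
        obtain ⟨_, ⟨u, hu, rfl⟩, hul⟩ := sInf_lt_iff.1 (hT.trans_lt hlt')
        have := EReal.coe_lt_coe_iff.1 hul
        exact ⟨u, by linarith, hu.2.2⟩
    obtain ⟨u, hu, v, hv, hva, hvb⟩ := key
    rcases List.prefix_or_prefix_of_prefix hwa.2 hva.2 with hwv | hvw
    · exact ⟨w, hw, hwa, hwa.1.trans (hva.1.symm.trans hvb.1), hwv.trans hvb.2⟩
    · by_cases hne : v = w
      · exact ⟨w, hw, hwa, hne ▸ hvb⟩
      · have := h.death_le_birth ⟨hva.1.trans hwa.1.symm, hvw⟩ hne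
        exact absurd hv.2.2 (not_lt.2 (this.trans hu))
  · intro hc
    exact sInf_le ⟨t₁, ⟨h0, h1, hc⟩, rfl⟩

/-- At `u = t` the only candidates are the founders, all extant at time `0` since lifetimes are
positive. Conversely a common ancestor forces a common founder. -/
lemma pairCoalTime_eq_top_iff {ω : Tree x} (h : Good ω) {t : ℝ} (h0 : 0 < t) (a b : Ind x) :
    pairCoalTime t ω a b = ⊤ ↔ a.1 ≠ b.1 := by
  constructor
  · intro hT hab
    have hle : pairCoalTime t ω a b ≤ (t : EReal) := by
      refine sInf_le ⟨t, ⟨h0, le_rfl, (a.1, []), ⟨exists_of_snd_eq_nil ω a.1, ?_, ?_⟩, ?_, ?_⟩, rfl⟩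
      · simp [birth]
      · simpa [birth, death] using h (a.1, [])
      · exact ⟨rfl, List.nil_prefix⟩
      · exact ⟨hab, List.nil_prefix⟩
    rw [hT] at hle
    exact absurd hle (not_le.2 (EReal.coe_lt_top t))
  · intro hab
    have : {u | 0 < u ∧ u ≤ t ∧ CommonAncestorAt ω (t - u) a b} = ∅ := by
      rw [eq_empty_iff_forall_notMem]
      rintro u ⟨-, -, hu⟩
      exact hab hu.fst_eq
    rw [pairCoalTime, this, image_empty, sInf_empty]

/-- The ordered pairs of individuals extant at time `t` that descend from distinct founders. -/
def foreignPairs (t : ℝ) (ω : Tree x) : Set (Ind x × Ind x) :=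
  {p | p ∈ (alive ω t).offDiag ∧ p.1.1 ≠ p.2.1}

lemma encard_foreignPairs (ω : Tree x) (t : ℝ) :
    (foreignPairs t ω).encard =
      ∑ i, ∑ j, if i = j then 0 else Z t (comp ω i) * Z t (comp ω j) := by
  rw [encard_eq_sum_fiber _ (fun p => p.1.1)]
  refine Finset.sum_congr rfl fun i _ => ?_
  rw [encard_eq_sum_fiber _ (fun p => p.2.1)]
  refine Finset.sum_congr rfl fun j _ => ?_
  split_ifs with hij
  · rw [encard_eq_zero, eq_empty_iff_forall_notMem]
    rintro ⟨a, b⟩ ⟨⟨⟨-, h⟩, h1⟩, h2⟩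
    simp only [mem_preimage, mem_singleton_iff] at h h1 h2
    exact h (by rw [h1, h2, hij])
  · have : foreignPairs t ω ∩ (fun p => p.1.1) ⁻¹' {i} ∩ (fun p => p.2.1) ⁻¹' {j} =
        (alive ω t ∩ Prod.fst ⁻¹' {i}) ×ˢ (alive ω t ∩ Prod.fst ⁻¹' {j}) := by
      ext ⟨a, b⟩
      simp only [foreignPairs, mem_inter_iff, mem_ofPred_eq, mem_offDiag, mem_preimage,
        mem_singleton_iff, mem_prod]
      constructor
      · rintro ⟨⟨⟨⟨h1, h2, -⟩, -⟩, h3⟩, h4⟩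
        exact ⟨⟨h1, h3⟩, h2, h4⟩
      · rintro ⟨⟨h1, h3⟩, h2, h4⟩
        refine ⟨⟨⟨⟨h1, h2, ?_⟩, ?_⟩, h3⟩, h4⟩
        · rintro rfl
          exact hij (h3.symm.trans h4)
        · rw [h3, h4]
          exact hij
    rw [this, encard_prod, alive_inter_fiber, alive_inter_fiber, (inj_injective i).encard_image,
      (inj_injective j).encard_image]
    rfl

end

section

variable {x : ℕ}

/-! ### Measurability -/

/-- The cardinality is a countable sum of indicators, measurable in `ℝ≥0∞`; measurability descends
to `ℕ∞` through the fibres over the naturals. -/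
lemma measurable_encard {Ω β : Type*} [MeasurableSpace Ω] [Countable β] {S : Ω → Set β}
    (hS : ∀ b, MeasurableSet {ω | b ∈ S ω}) : Measurable fun ω => (S ω).encard := by
  classical
  have h1 : Measurable fun ω => ((S ω).encard : ℝ≥0∞) := by
    have : (fun ω => ((S ω).encard : ℝ≥0∞)) =
        fun ω => ∑' b, {ω | b ∈ S ω}.indicator (fun _ => (1 : ℝ≥0∞)) ω := by
      funext ω
      rw [← ENNReal.tsum_set_one, tsum_subtype (S ω) (fun _ => (1 : ℝ≥0∞))]
      rfl
    rw [this]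
    exact Measurable.tsum fun b => measurable_const.indicator (hS b)
  refine measurable_to_countable' fun n => ?_
  have : (fun ω => (S ω).encard) ⁻¹' {n} = (fun ω => ((S ω).encard : ℝ≥0∞)) ⁻¹' {(n : ℝ≥0∞)} := by
    ext ω
    simp
  rw [this]
  exact h1 (measurableSet_singleton _)

lemma measurable_birth (a : Ind x) : Measurable fun ω : Tree x => birth ω a :=
  Finset.measurable_sum _ fun _ _ => measurable_fst.comp (measurable_pi_apply _)

lemma measurable_death (a : Ind x) : Measurable fun ω : Tree x => death ω a :=
  (measurable_birth a).add (measurable_fst.comp (measurable_pi_apply _))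

lemma measurableSet_exists (a : Ind x) : MeasurableSet {ω : Tree x | Exists ω a} := by
  simp only [Exists, ofPred_forall]
  refine MeasurableSet.iInter fun v => MeasurableSet.iInter fun k => MeasurableSet.iInter fun _ => ?_
  exact measurableSet_lt measurable_const (measurable_snd.comp (measurable_pi_apply _))

lemma measurableSet_alive (a : Ind x) :
    MeasurableSet {p : ℝ × Tree x | a ∈ alive p.2 p.1} := by
  refine (measurable_snd (measurableSet_exists a)).inter (MeasurableSet.inter ?_ ?_)
  · exact measurableSet_le ((measurable_birth a).comp measurable_snd) measurable_fst
  · exact measurableSet_lt measurable_fst ((measurable_death a).comp measurable_snd)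

lemma measurable_Z_prod : Measurable fun p : ℝ × Tree x => Z p.1 p.2 :=
  measurable_encard measurableSet_alive

lemma measurable_Z (t : ℝ) : Measurable (Z (x := x) t) :=
  measurable_Z_prod.comp measurable_prodMk_left

lemma measurableSet_commonAncestorAt (r : ℝ) (a b : Ind x) :
    MeasurableSet {p : ℝ × Tree x | CommonAncestorAt p.2 (p.1 - r) a b} := by
  have : {p : ℝ × Tree x | CommonAncestorAt p.2 (p.1 - r) a b} =
      ⋃ v, ⋃ _ : IsAncestor v a ∧ IsAncestor v b, {p : ℝ × Tree x | v ∈ alive p.2 (p.1 - r)} := by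
    ext p
    simp only [CommonAncestorAt, mem_ofPred_eq, mem_iUnion, exists_prop]
    exact ⟨fun ⟨v, h1, h2⟩ => ⟨v, h2, h1⟩, fun ⟨v, h1, h2⟩ => ⟨v, h2, h1⟩⟩
  rw [this]
  refine MeasurableSet.iUnion fun v => MeasurableSet.iUnion fun _ => ?_
  exact (measurableSet_alive v).preimage
    ((measurable_fst.sub_const r).prodMk measurable_snd)

lemma measurableSet_offDiag_alive (q : Ind x × Ind x) :
    MeasurableSet {p : ℝ × Tree x | q ∈ (alive p.2 p.1).offDiag} :=
  (measurableSet_alive q.1).inter ((measurableSet_alive q.2).inter (MeasurableSet.const _))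

lemma measurable_encard_pairs (r : ℝ) :
    Measurable fun p : ℝ × Tree x => (pairs (p.1 - r) p.1 p.2).encard :=
  measurable_encard fun q =>
    (measurableSet_offDiag_alive q).inter (measurableSet_commonAncestorAt r q.1 q.2)

lemma measurable_comp (i : Fin x) : Measurable fun ω : Tree x => comp ω i :=
  measurable_pi_lambda _ fun _ => measurable_pi_apply _

/-! ### The law of the tree -/

variable (μ : Measure ℕ) [IsFiniteMeasure μ] [NeZero μ]

instance (x : ℕ) : IsProbabilityMeasure (law μ x) := by
  unfold law
  infer_instance

/-- The factor `μ(ℕ)` of the exponential density cancels the normalization of the offspring law, so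
`μ` appears unnormalized from here on. -/
lemma lintegral_vecLaw {F : ℝ × ℕ → ℝ≥0∞} (hF : Measurable F) :
    ∫⁻ p, F p ∂vecLaw μ = ∫⁻ u in Ioi (0 : ℝ),
      ENNReal.ofReal (Real.exp (-(μ.real univ * u))) * ∑' k, μ {k} * F (u, k) := by
  have hc : 0 < μ.real univ := measureReal_univ_pos
  have := isProbabilityMeasure_expMeasure hc
  have hS : Measurable fun u => ∑' k, μ {k} * F (u, k) :=
    Measurable.tsum fun k => (hF.comp (measurable_id.prodMk measurable_const)).const_mul _
  unfold vecLaw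
  rw [lintegral_prod _ hF.aemeasurable]
  have h1 : ∀ u, ∫⁻ k, F (u, k) ∂((μ univ)⁻¹ • μ) = (μ univ)⁻¹ * ∑' k, μ {k} * F (u, k) := by
    intro u
    rw [lintegral_smul_measure, lintegral_countable', smul_eq_mul]
    simp only [mul_comm]
  simp only [h1]
  have hpdf : Measurable (gammaPDF 1 (μ.real univ)) := (measurable_gammaPDFReal 1 _).ennreal_ofReal
  rw [expMeasure, gammaMeasure, lintegral_withDensity_eq_lintegral_mul _ hpdf (hS.const_mul _),
    ← lintegral_indicator measurableSet_Ioi]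
  refine lintegral_congr_ae ?_
  filter_upwards [compl_mem_ae_iff.2 (measure_singleton (0 : ℝ))] with u hu
  have hg : gammaPDF 1 (μ.real univ) u = exponentialPDF (μ.real univ) u := rfl
  rw [Pi.mul_apply, hg, exponentialPDF_eq, indicator_apply]
  rcases lt_or_gt_of_ne (show u ≠ 0 from hu) with h | h
  · rw [if_neg h.not_ge, if_neg (show u ∉ Ioi (0 : ℝ) from h.not_gt)]
    simp
  · rw [if_pos h.le, if_pos (show u ∈ Ioi (0 : ℝ) from h), ENNReal.ofReal_mul hc.le,
      ofReal_measureReal, ← mul_assoc, mul_right_comm (μ univ), ENNReal.mul_inv_cancel, one_mul]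
    · exact NeZero.ne _
    · exact measure_ne_top _ _

lemma vecLaw_fst_nonpos : vecLaw μ {p | p.1 ≤ 0} = 0 := by
  have hm : MeasurableSet {p : ℝ × ℕ | p.1 ≤ 0} := measurableSet_le measurable_fst measurable_const
  rw [← lintegral_indicator_one hm, lintegral_vecLaw μ (measurable_one.indicator hm),
    setLIntegral_congr_fun (g := fun _ => 0) measurableSet_Ioi, lintegral_zero]
  intro u hu
  have : ∀ k : ℕ, (u, k) ∉ {p : ℝ × ℕ | p.1 ≤ 0} := fun k => not_le.2 (mem_Ioi.1 hu)
  simp [indicator_of_notMem (this _)]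

lemma vecLaw_fst_eq (r : ℝ) : vecLaw μ {p | p.1 = r} = 0 := by
  have hm : MeasurableSet {p : ℝ × ℕ | p.1 = r} :=
    measurableSet_eq_fun measurable_fst measurable_const
  rw [← lintegral_indicator_one hm, lintegral_vecLaw μ (measurable_one.indicator hm)]
  refine lintegral_eq_zero_of_ae_eq_zero (ae_restrict_of_ae ?_)
  filter_upwards [compl_mem_ae_iff.2 (measure_singleton r)] with u hu
  have : ∀ k : ℕ, (u, k) ∉ {p : ℝ × ℕ | p.1 = r} := fun k => hu
  simp [indicator_of_notMem (this _)]

lemma law_map_eval (x : ℕ) (a : Ind x) : (law μ x).map (fun ω => ω a) = vecLaw μ :=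
  Measure.infinitePi_map_eval _ a

lemma ae_good (x : ℕ) : ∀ᵐ ω ∂law μ x, Good ω := by
  refine ae_all_iff.2 fun a => ?_
  have h : ∀ᵐ p ∂(law μ x).map (fun ω => ω a), 0 < p.1 := by
    rw [law_map_eval, ae_iff]
    simpa only [not_lt] using vecLaw_fst_nonpos μ
  exact ae_of_ae_map (measurable_pi_apply a).aemeasurable h

lemma infinitePi_map_precomp {I J X : Type*} [MeasurableSpace X] (ν : Measure X)
    [IsProbabilityMeasure ν] {f : J → I} (hf : Function.Injective f) :
    (Measure.infinitePi fun _ : I => ν).map (fun ω j => ω (f j)) =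
      Measure.infinitePi fun _ : J => ν :=
  Measure.map_infinitePi_infinitePi_of_inj hf

lemma law_map_comp (i : Fin x) : (law μ x).map (fun ω => comp ω i) = law μ 1 :=
  infinitePi_map_precomp (vecLaw μ) (inj_injective i)

/-- The subtrees of the founders read disjoint blocks of an i.i.d. family; currying the product
measure on `Fin x × Ind 1` expresses this. -/
lemma iIndepFun_comp (x : ℕ) : iIndepFun (fun (i : Fin x) (ω : Tree x) => comp ω i) (law μ x) := by
  rw [iIndepFun_iff_map_fun_eq_infinitePi_map measurable_comp]
  simp only [law_map_comp]
  have hf : Function.Injective fun p : Fin x × Ind 1 => inj p.1 p.2 := by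
    rintro ⟨i, a⟩ ⟨j, b⟩ h
    have hij : i = j := congrArg Prod.fst h
    subst hij
    rw [inj_injective i (a₁ := a) (a₂ := b) h]
  have h1 := infinitePi_map_precomp (vecLaw μ) hf
  have h2 := Measure.infinitePi_map_curry (fun (_ : Fin x) (_ : Ind 1) => vecLaw μ)
  rw [← h1, Measure.map_map (by fun_prop) (by fun_prop)] at h2
  exact h2

lemma lintegral_prod_comp {f : Fin x → Tree 1 → ℝ≥0∞} (hf : ∀ i, Measurable (f i)) :
    ∫⁻ ω, ∏ i, f i (comp ω i) ∂law μ x = ∏ i, ∫⁻ τ, f i τ ∂law μ 1 := by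
  have h := lintegral_prod_eq_prod_lintegral_of_indepFun Finset.univ
    (fun i ω => f i (comp ω i)) ((iIndepFun_comp μ x).comp f hf)
    (fun i => (hf i).comp (measurable_comp i))
  rw [h]
  refine Finset.prod_congr rfl fun i _ => ?_
  rw [← law_map_comp μ i, lintegral_map (hf i) (measurable_comp i)]

/-- The lifetimes and numbers of offspring of all the individuals except the root; all children
of the root are kept, whether they are born or not. -/
def rest (τ : Tree 1) : ℕ × List ℕ → ℝ × ℕ := fun a => τ (0, a.1 :: a.2)

/-- The first `k` trees of an infinite forest. -/
def trunc (k : ℕ) (η : ℕ × List ℕ → ℝ × ℕ) : Tree k := fun a => η (a.1, a.2)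

lemma measurable_trunc (k : ℕ) : Measurable (trunc k) :=
  measurable_pi_lambda _ fun _ => measurable_pi_apply _

lemma measurable_rest : Measurable rest :=
  measurable_pi_lambda _ fun _ => measurable_pi_apply _

lemma infinitePi_map_trunc (k : ℕ) :
    (Measure.infinitePi fun _ : ℕ × List ℕ => vecLaw μ).map (trunc k) = law μ k := by
  refine infinitePi_map_precomp (vecLaw μ) (f := fun a : Ind k => ((a.1 : ℕ), a.2)) ?_
  rintro ⟨i, v⟩ ⟨j, w⟩ h
  simp only [Prod.mk.injEq] at h
  exact Prod.ext (Fin.ext h.1) h.2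

/-- The vector of the root is independent of all other vectors. Keeping unborn children in `rest` is
what makes this true, since the set of born children depends on the root. -/
lemma law_map_root_rest : (law μ 1).map (fun τ => (τ root, rest τ)) =
    (vecLaw μ).prod (Measure.infinitePi fun _ : ℕ × List ℕ => vecLaw μ) := by
  set Q := Measure.infinitePi fun _ : ℕ × List ℕ => vecLaw μ with hQ
  -- The Boolean separates the root from the rest, so that currying over `Bool` yields two
  -- independent copies of `Q`. The root reads one coordinate of the first, the rest is the whole
  -- second copy.
  set f : Ind 1 → Bool × (ℕ × List ℕ) := fun a => match a.2 with
    | [] => (false, (0, []))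
    | i :: v => (true, (i, v)) with hfdef
  have hf : Function.Injective f := by
    rintro ⟨a, v⟩ ⟨b, w⟩ h
    obtain rfl := Subsingleton.elim a b
    rcases v with _ | ⟨i, v⟩ <;> rcases w with _ | ⟨j, w⟩ <;> simp_all
  have h1 : law μ 1 = _ := (infinitePi_map_precomp (vecLaw μ) hf).symm
  have h2 := Measure.infinitePi_map_curry (fun (_ : Bool) (_ : ℕ × List ℕ) => vecLaw μ)
  have h3 := Measure.infinitePi_map_eval_prod (P := fun _ : Bool => Q)
    (i := false) (j := true) (by simp)
  rw [← h2, Measure.map_map (by fun_prop) (by fun_prop)] at h3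
  have h4 : vecLaw μ = Q.map (fun η => η (0, [])) :=
    (Measure.infinitePi_map_eval (fun _ : ℕ × List ℕ => vecLaw μ) (0, [])).symm
  have h5 : (vecLaw μ).prod Q = (Q.prod Q).map (Prod.map (fun η => η (0, [])) id) := by
    rw [← Measure.map_prod_map _ _ (by fun_prop) measurable_id, ← h4, Measure.map_id]
  rw [h5, ← h3, h1, Measure.map_map (((measurable_pi_apply _).prodMk measurable_rest))
    (by fun_prop), Measure.map_map (by fun_prop) (by fun_prop)]
  rfl

/-- Decomposition at the death of the founder. -/
lemma lintegral_law_one {F : ℝ → (k : ℕ) → Tree k → ℝ≥0∞}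
    (hF : ∀ k, Measurable fun p : ℝ × Tree k => F p.1 k p.2) :
    ∫⁻ τ, F (τ root).1 (τ root).2 (children τ (τ root).2) ∂law μ 1 =
      ∫⁻ u in Ioi (0 : ℝ), ENNReal.ofReal (Real.exp (-(μ.real univ * u))) *
        ∑' k, μ {k} * ∫⁻ ω, F u k ω ∂law μ k := by
  set Q := Measure.infinitePi fun _ : ℕ × List ℕ => vecLaw μ with hQ
  have hm : Measurable fun q : (ℝ × ℕ) × (ℕ × List ℕ → ℝ × ℕ) => F q.1.1 q.1.2 (trunc q.1.2 q.2) := by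
    -- The type of the forest depends on the number of children, so measurability is checked for
    -- each of its countably many values.
    have : Measurable fun q : (ℝ × (ℕ × List ℕ → ℝ × ℕ)) × ℕ => F q.1.1 q.2 (trunc q.2 q.1.2) :=
      measurable_from_prod_countable_left fun k =>
        (hF k).comp (measurable_fst.prodMk ((measurable_trunc k).comp measurable_snd))
    exact this.comp (f := fun q : (ℝ × ℕ) × (ℕ × List ℕ → ℝ × ℕ) => ((q.1.1, q.2), q.1.2))
      (by fun_prop)
  have h1 : ∫⁻ τ, F (τ root).1 (τ root).2 (children τ (τ root).2) ∂law μ 1 =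
      ∫⁻ q, F q.1.1 q.1.2 (trunc q.1.2 q.2) ∂((law μ 1).map fun τ => (τ root, rest τ)) := by
    rw [lintegral_map hm ((measurable_pi_apply _).prodMk measurable_rest)]
    rfl
  rw [h1, law_map_root_rest, lintegral_prod _ hm.aemeasurable,
    lintegral_vecLaw μ hm.lintegral_prod_right']
  refine lintegral_congr fun u => ?_
  congr 1
  refine tsum_congr fun k => ?_
  congr 1
  rw [← infinitePi_map_trunc μ k, lintegral_map (f := F u k) ((hF k).comp measurable_prodMk_left)
    (measurable_trunc k)]

/-- The birth time of a non-founder is the lifetime of its founder plus an independent quantity, and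
the exponential law has no atoms. -/
lemma ae_birth_ne (x : ℕ) (r : ℝ) :
    ∀ᵐ ω ∂law μ x, ∀ v : Ind x, v.2 ≠ [] → birth ω v ≠ r := by
  have h1 : ∀ (j : ℕ) (l : List ℕ), ∀ᵐ τ ∂law μ 1, birth τ (0, j :: l) ≠ r := by
    intro j l
    set D : (ℕ × List ℕ → ℝ × ℕ) → ℝ := fun η =>
      birth (trunc (j + 1) η) (⟨j, Nat.lt_succ_self j⟩, l) with hD
    have hDm : Measurable D := (measurable_birth _).comp (measurable_trunc _)
    have hm : MeasurableSet {q : (ℝ × ℕ) × (ℕ × List ℕ → ℝ × ℕ) | q.1.1 + D q.2 = r} :=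
      measurableSet_eq_fun (by fun_prop) measurable_const
    have h2 : ∀ᵐ q ∂((law μ 1).map fun τ => (τ root, rest τ)), q.1.1 + D q.2 ≠ r := by
      rw [law_map_root_rest, ae_iff]
      simp only [not_not]
      rw [Measure.prod_apply_symm hm]
      refine lintegral_eq_zero_of_ae_eq_zero (Filter.Eventually.of_forall fun η => ?_)
      have : (fun p : ℝ × ℕ => (p, η)) ⁻¹' {q | q.1.1 + D q.2 = r} = {p | p.1 = r - D η} := by
        ext p
        exact eq_sub_iff_add_eq.symm
      simp only [this, vecLaw_fst_eq, Pi.zero_apply]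
    filter_upwards [ae_of_ae_map ((measurable_pi_apply _).prodMk measurable_rest).aemeasurable h2]
      with τ hτ
    have := birth_graft τ ((⟨j, Nat.lt_succ_self j⟩, l) : Ind (j + 1))
    rw [show ((0, j :: l) : Ind 1) = graft ((⟨j, Nat.lt_succ_self j⟩, l) : Ind (j + 1)) from rfl,
      this]
    exact hτ
  refine ae_all_iff.2 ?_
  rintro ⟨i, l⟩
  rcases l with _ | ⟨j, l⟩
  · exact Filter.Eventually.of_forall fun _ h => absurd rfl h
  · have := h1 j l
    rw [← law_map_comp μ i] at this
    filter_upwards [ae_of_ae_map (measurable_comp i).aemeasurable this] with ω hω _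
    exact hω

end

section

variable {x : ℕ}

/-! ### Weights -/

/-- `s ^ z`, with the convention `s ^ ∞ = 0`. -/
noncomputable def weight (s : ℝ) (z : ℕ∞) : ℝ≥0∞ := if z = ⊤ then 0 else ENNReal.ofReal (s ^ z.toNat)

@[simp] lemma weight_top (s : ℝ) : weight s ⊤ = 0 := if_pos rfl

@[simp] lemma weight_coe (s : ℝ) (n : ℕ) : weight s n = ENNReal.ofReal (s ^ n) := by
  simp [weight]

@[simp] lemma weight_zero (s : ℝ) : weight s 0 = 1 := by
  rw [← Nat.cast_zero, weight_coe, pow_zero, ENNReal.ofReal_one]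

@[simp] lemma weight_one (s : ℝ) : weight s 1 = ENNReal.ofReal s := by
  rw [← Nat.cast_one, weight_coe, pow_one]

/-- The convention `s ^ ∞ = 0` keeps the weight multiplicative on all of `ℕ∞`, so explosion needs no
separate treatment. -/
lemma weight_add {s : ℝ} (hs : 0 ≤ s) (y z : ℕ∞) :
    weight s (y + z) = weight s y * weight s z := by
  induction y using ENat.recTopCoe with
  | top => simp
  | coe m =>
    induction z using ENat.recTopCoe with
    | top => simp
    | coe n => rw [← Nat.cast_add, weight_coe, weight_coe, weight_coe, pow_add,
        ENNReal.ofReal_mul (pow_nonneg hs m)]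

lemma weight_sum {s : ℝ} (hs : 0 ≤ s) {ι : Type*} (I : Finset ι) (z : ι → ℕ∞) :
    weight s (∑ i ∈ I, z i) = ∏ i ∈ I, weight s (z i) := by
  classical
  induction I using Finset.induction_on with
  | empty => simp
  | insert i I hi ih => rw [Finset.sum_insert hi, Finset.prod_insert hi, weight_add hs, ih]

lemma weight_Z_eq_prod {s : ℝ} (hs : 0 ≤ s) (t : ℝ) (ω : Tree x) :
    weight s (Z t ω) = ∏ i, weight s (Z t (comp ω i)) := by
  rw [Z_eq_sum, weight_sum hs]

lemma measurable_weight_Z (s t : ℝ) : Measurable fun ω : Tree x => weight s (Z t ω) :=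
  (Measurable.of_discrete (f := weight s)).comp (measurable_Z t)

variable (μ : Measure ℕ) [IsFiniteMeasure μ] [NeZero μ]

/-- `𝔼_1(s^{Z_t})`, with values in `ℝ≥0∞`. -/
noncomputable def egf (t s : ℝ) : ℝ≥0∞ := ∫⁻ τ, weight s (Z t τ) ∂law μ 1

lemma lintegral_weight_Z {s : ℝ} (hs : 0 ≤ s) (x : ℕ) (t : ℝ) :
    ∫⁻ ω, weight s (Z t ω) ∂law μ x = egf μ t s ^ x := by
  rw [lintegral_congr (weight_Z_eq_prod hs t), lintegral_prod_comp μ (f := fun _ τ => weight s (Z t τ))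
    (fun _ => measurable_weight_Z s t)]
  simp [egf]

/-- In the term of founder `i`, the product of weights is altered only in its `i`-th factor, and
independence factorizes the mean. For `x = 0` the truncated exponent is harmless because of the
factor `x`. -/
lemma lintegral_sum_mul_weight_Z {s : ℝ} (hs : 0 ≤ s) (x : ℕ) (t : ℝ) {B : Tree 1 → ℝ≥0∞}
    (hB : Measurable B) :
    ∫⁻ ω, (∑ i, B (comp ω i)) * weight s (Z t ω) ∂law μ x =
      x * egf μ t s ^ (x - 1) * ∫⁻ τ, B τ * weight s (Z t τ) ∂law μ 1 := by
  classical
  set f : Fin x → Fin x → Tree 1 → ℝ≥0∞ := fun i => Function.update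
    (fun _ τ => weight s (Z t τ)) i (fun τ => B τ * weight s (Z t τ)) with hf
  have hfm : ∀ i j, Measurable (f i j) := by
    intro i j
    rcases eq_or_ne j i with rfl | h
    · simp only [hf, Function.update_self]
      exact hB.mul (measurable_weight_Z s t)
    · simpa [hf, Function.update_of_ne h] using measurable_weight_Z s t
  have h1 : ∀ ω : Tree x, (∑ i, B (comp ω i)) * weight s (Z t ω) =
      ∑ i, ∏ j, f i j (comp ω j) := by
    intro ω
    rw [Finset.sum_mul]
    refine Finset.sum_congr rfl fun i _ => ?_
    rw [weight_Z_eq_prod hs, ← Finset.mul_prod_erase _ _ (Finset.mem_univ i),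
      ← Finset.mul_prod_erase _ _ (Finset.mem_univ i), ← mul_assoc]
    congr 1
    · simp [hf]
    · refine Finset.prod_congr rfl fun j hj => ?_
      simp [hf, Function.update_of_ne (Finset.ne_of_mem_erase hj)]
  simp only [h1]
  have hm : ∀ i, Measurable fun ω : Tree x => ∏ j, f i j (comp ω j) := fun i =>
    Finset.measurable_prod _ fun j _ => (hfm i j).comp (measurable_comp j)
  rw [lintegral_finsetSum _ fun i _ => hm i]
  have h2 : ∀ i, ∫⁻ ω, ∏ j, f i j (comp ω j) ∂law μ x =
      egf μ t s ^ (x - 1) * ∫⁻ τ, B τ * weight s (Z t τ) ∂law μ 1 := by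
    intro i
    rw [lintegral_prod_comp μ (hfm i), ← Finset.mul_prod_erase _ _ (Finset.mem_univ i), mul_comm]
    congr 1
    · rw [Finset.prod_congr rfl (g := fun _ => egf μ t s), Finset.prod_const,
        Finset.card_erase_of_mem (Finset.mem_univ i), Finset.card_univ, Fintype.card_fin]
      intro j hj
      simp [hf, Function.update_of_ne (Finset.ne_of_mem_erase hj), egf]
    · simp [hf]
  simp only [h2, Finset.sum_const, Finset.card_univ, Fintype.card_fin, nsmul_eq_mul, mul_assoc]

lemma toENNReal_sum {ι : Type*} (I : Finset ι) (z : ι → ℕ∞) :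
    ((∑ i ∈ I, z i : ℕ∞) : ℝ≥0∞) = ∑ i ∈ I, (z i : ℝ≥0∞) :=
  map_sum ENat.toENNRealRingHom z I

lemma lintegral_foreignPairs {s : ℝ} (hs : 0 ≤ s) (x : ℕ) (t : ℝ) :
    ∫⁻ ω, ((foreignPairs t ω).encard : ℝ≥0∞) * weight s (Z t ω) ∂law μ x =
      x * (x - 1 : ℕ) * egf μ t s ^ (x - 2) *
        (∫⁻ τ, (Z t τ : ℝ≥0∞) * weight s (Z t τ) ∂law μ 1) ^ 2 := by
  classical
  set G := ∫⁻ τ, (Z t τ : ℝ≥0∞) * weight s (Z t τ) ∂law μ 1 with hG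
  have hZm : Measurable fun τ : Tree 1 => (Z t τ : ℝ≥0∞) * weight s (Z t τ) :=
    (Measurable.of_discrete (f := fun z : ℕ∞ => (z : ℝ≥0∞) * weight s z)).comp (measurable_Z t)
  set f : Fin x → Fin x → Fin x → Tree 1 → ℝ≥0∞ := fun i j k τ =>
    if k = i ∨ k = j then (Z t τ : ℝ≥0∞) * weight s (Z t τ) else weight s (Z t τ) with hf
  have hfm : ∀ i j k, Measurable (f i j k) := by
    intro i j k
    simp only [hf]
    split_ifs
    · exact hZm
    · exact measurable_weight_Z s t
  have h1 : ∀ ω : Tree x, ((foreignPairs t ω).encard : ℝ≥0∞) * weight s (Z t ω) =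
      ∑ i, ∑ j ∈ Finset.univ.erase i, ∏ k, f i j k (comp ω k) := by
    intro ω
    rw [encard_foreignPairs, toENNReal_sum, Finset.sum_mul]
    refine Finset.sum_congr rfl fun i _ => ?_
    rw [toENNReal_sum, Finset.sum_mul, ← Finset.add_sum_erase _ _ (Finset.mem_univ i)]
    simp only [if_true, ENat.toENNReal_zero, zero_mul, zero_add]
    refine Finset.sum_congr rfl fun j hj => ?_
    have hij : i ≠ j := (Finset.ne_of_mem_erase hj).symm
    rw [if_neg hij, weight_Z_eq_prod hs, ← Finset.mul_prod_erase _ _ (Finset.mem_univ i),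
      ← Finset.mul_prod_erase _ _ hj, ← Finset.mul_prod_erase _ _ (Finset.mem_univ i),
      ← Finset.mul_prod_erase _ _ hj, ENat.toENNReal_mul]
    have h2 : ∀ k ∈ (Finset.univ.erase i).erase j, f i j k (comp ω k) =
        weight s (Z t (comp ω k)) := by
      intro k hk
      simp only [hf]
      rw [if_neg]
      rintro (rfl | rfl)
      · simp at hk
      · simp at hk
    rw [Finset.prod_congr rfl h2]
    simp only [hf, true_or, or_true, if_true]
    ring
  simp only [h1]
  have hm : ∀ i j, Measurable fun ω : Tree x => ∏ k, f i j k (comp ω k) := fun i j =>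
    Finset.measurable_prod _ fun k _ => (hfm i j k).comp (measurable_comp k)
  rw [lintegral_finsetSum _ fun i _ => Finset.measurable_sum _ fun j _ => hm i j]
  have h2 : ∀ i, ∫⁻ ω, ∑ j ∈ Finset.univ.erase i, ∏ k, f i j k (comp ω k) ∂law μ x =
      (x - 1 : ℕ) * (egf μ t s ^ (x - 2) * G ^ 2) := by
    intro i
    rw [lintegral_finsetSum _ fun j _ => hm i j,
      Finset.sum_congr rfl (g := fun _ => egf μ t s ^ (x - 2) * G ^ 2), Finset.sum_const,
      Finset.card_erase_of_mem (Finset.mem_univ i), Finset.card_univ, Fintype.card_fin,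
      nsmul_eq_mul]
    intro j hj
    rw [lintegral_prod_comp μ (hfm i j), ← Finset.mul_prod_erase _ _ (Finset.mem_univ i),
      ← Finset.mul_prod_erase _ _ hj, Finset.prod_congr rfl (g := fun _ => egf μ t s),
      Finset.prod_const, Finset.card_erase_of_mem hj,
      Finset.card_erase_of_mem (Finset.mem_univ i), Finset.card_univ, Fintype.card_fin]
    · simp only [hf, true_or, or_true, if_true, ← hG, Nat.sub_sub]
      ring
    · intro k hk
      have hk' : ¬ (k = i ∨ k = j) := by
        rintro (rfl | rfl) <;> simp at hk
      simp only [hf, hk', if_false, egf]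
  simp only [h2, Finset.sum_const, Finset.card_univ, Fintype.card_fin, nsmul_eq_mul, mul_assoc]

/-! ### The renewal equation -/

lemma setLIntegral_Ioi_add (g : ℝ → ℝ≥0∞) (a : ℝ) :
    ∫⁻ u in Ioi a, g u = ∫⁻ v in Ioi (0 : ℝ), g (v + a) := by
  rw [← lintegral_indicator measurableSet_Ioi, ← lintegral_indicator measurableSet_Ioi,
    ← lintegral_add_right_eq_self _ a]
  refine lintegral_congr fun v => ?_
  simp only [indicator_apply, mem_Ioi]
  congr 1
  simp

lemma lintegral_comp_Z (f : ℕ∞ → ℝ≥0∞) {b : ℝ} (hb : 0 ≤ b) :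
    ∫⁻ τ, f (Z b τ) ∂law μ 1 =
      ∫⁻ u in Ioi (0 : ℝ), ENNReal.ofReal (Real.exp (-(μ.real univ * u))) *
        ∑' k, μ {k} * ∫⁻ ω : Tree k, (if b < u then f 1 else f (Z (b - u) ω)) ∂law μ k := by
  rw [← lintegral_law_one μ (F := fun u k ω => if b < u then f 1 else f (Z (b - u) ω))]
  · refine lintegral_congr_ae ?_
    filter_upwards [ae_good μ 1] with τ hτ
    split_ifs with h
    · rw [hτ.Z_of_lt hb h]
    · rw [Z_of_le (not_lt.1 h)]
  · intro k
    refine Measurable.ite (measurableSet_lt measurable_const measurable_fst) measurable_const ?_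
    exact (Measurable.of_discrete (f := f)).comp (measurable_Z_prod.comp
      ((measurable_fst.const_sub b).prodMk measurable_snd))

/-- A common renewal equation for `ψ`, the mean size (both with `b = 0`) and the mean number of
pairs. If the founder outlives `t - b`, memorylessness makes its residual life exponential, so the
tree restarts afresh and the contribution is `e^{-c(t-b)} 𝔼_1(f(Z_b))`; otherwise the functional
passes to the children. -/
lemma lintegral_renewal {b : ℝ} (hb : 0 ≤ b) (f : ℕ∞ → ℝ≥0∞)
    {F : (k : ℕ) → ℝ → Tree k → ℝ≥0∞}
    (hF : ∀ k, Measurable fun p : ℝ × Tree k => F k p.1 p.2)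
    (h1 : ∀ τ t, b ≤ t → t - b < (τ root).1 → F 1 t τ = f (Z t τ))
    (h2 : ∀ τ t, b ≤ t → (τ root).1 ≤ t - b →
      F 1 t τ = F (τ root).2 (t - (τ root).1) (children τ (τ root).2))
    {t : ℝ} (ht : b ≤ t) :
    ∫⁻ τ, F 1 t τ ∂law μ 1 =
      ENNReal.ofReal (Real.exp (-(μ.real univ * (t - b)))) * ∫⁻ τ, f (Z b τ) ∂law μ 1 +
        ∫⁻ u in Ioc 0 (t - b), ENNReal.ofReal (Real.exp (-(μ.real univ * u))) *
          ∑' k, μ {k} * ∫⁻ ω, F k (t - u) ω ∂law μ k := by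
  set K : ℝ → (k : ℕ) → Tree k → ℝ≥0∞ := fun u k ω =>
    if t - b < u then (if t < u then f 1 else f (Z (t - u) ω)) else F k (t - u) ω with hK
  have hKm : ∀ k, Measurable fun p : ℝ × Tree k => K p.1 k p.2 := by
    intro k
    refine Measurable.ite (measurableSet_lt measurable_const measurable_fst) ?_ ?_
    · refine Measurable.ite (measurableSet_lt measurable_const measurable_fst) measurable_const ?_
      exact (Measurable.of_discrete (f := f)).comp (measurable_Z_prod.comp
        ((measurable_fst.const_sub t).prodMk measurable_snd))
    · exact (hF k).comp ((measurable_fst.const_sub t).prodMk measurable_snd)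
  have h3 : ∫⁻ τ, F 1 t τ ∂law μ 1 =
      ∫⁻ τ, K (τ root).1 (τ root).2 (children τ (τ root).2) ∂law μ 1 := by
    refine lintegral_congr_ae ?_
    filter_upwards [ae_good μ 1] with τ hτ
    simp only [hK]
    split_ifs with h h'
    · rw [h1 τ t ht h, hτ.Z_of_lt (hb.trans ht) h']
    · rw [h1 τ t ht h, Z_of_le (not_lt.1 h')]
    · rw [h2 τ t ht (not_lt.1 h)]
  rw [h3, lintegral_law_one μ hKm, ← Ioc_union_Ioi_eq_Ioi (sub_nonneg.2 ht),
    lintegral_union measurableSet_Ioi (Ioc_disjoint_Ioi le_rfl), add_comm]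
  congr 1
  -- Memorylessness: shifting the lifetime by `t - b` extracts the exponential factor and leaves the
  -- decomposition of `f (Z b τ)`.
  · rw [setLIntegral_Ioi_add, lintegral_comp_Z μ f hb, ← lintegral_const_mul' _ _ ENNReal.ofReal_ne_top]
    refine setLIntegral_congr_fun measurableSet_Ioi fun v hv => ?_
    rw [← mul_assoc, ← ENNReal.ofReal_mul (Real.exp_pos _).le, ← Real.exp_add]
    congr 3
    · ring
    · refine funext fun k => ?_
      congr 1
      refine lintegral_congr fun ω => ?_
      have e1 : t - b < v + (t - b) := by linarith [mem_Ioi.1 hv]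
      simp only [hK, if_pos e1]
      have e2 : t < v + (t - b) ↔ b < v := by constructor <;> intro <;> linarith
      simp only [e2, show t - (v + (t - b)) = b - v by ring]
  · refine setLIntegral_congr_fun measurableSet_Ioc fun u hu => ?_
    simp only [hK, if_neg (not_lt.2 hu.2)]

lemma lintegral_comp_Z_zero (f : ℕ∞ → ℝ≥0∞) : ∫⁻ τ, f (Z 0 τ) ∂law μ 1 = f 1 := by
  have : ∫⁻ τ, f (Z 0 τ) ∂law μ 1 = ∫⁻ _, f 1 ∂law μ 1 := by
    refine lintegral_congr_ae ?_
    filter_upwards [ae_good μ 1] with τ hτ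
    rw [hτ.Z_of_lt le_rfl (hτ root)]
  rw [this, lintegral_const, measure_univ, mul_one]

/-- With `v = t - u` and the factor `e^{ct}`, the integrand no longer depends on `t`, so the
equation can be differentiated. -/
lemma renewal_change_time {c b t : ℝ} (R : ℝ → ℝ≥0∞) (C : ℝ≥0∞) :
    ENNReal.ofReal (Real.exp (c * t)) * (ENNReal.ofReal (Real.exp (-(c * (t - b)))) * C +
      ∫⁻ u in Ioc 0 (t - b), ENNReal.ofReal (Real.exp (-(c * u))) * R (t - u)) =
    ENNReal.ofReal (Real.exp (c * b)) * C +
      ∫⁻ v in Ioc b t, ENNReal.ofReal (Real.exp (c * v)) * R v := by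
  rw [mul_add, ← mul_assoc, ← ENNReal.ofReal_mul (Real.exp_pos _).le, ← Real.exp_add]
  congr 1
  · congr 3
    ring
  · rw [← lintegral_const_mul' _ _ ENNReal.ofReal_ne_top, ← restrict_Ico_eq_restrict_Ioc (a := b) (b := t),
      ← lintegral_indicator measurableSet_Ioc, ← lintegral_indicator measurableSet_Ico]
    refine Eq.trans ?_ (lintegral_sub_left_eq_self _ t)
    refine lintegral_congr fun u => ?_
    have e1 : u ∈ Ioc 0 (t - b) ↔ t - u ∈ Ico b t := by
      simp only [mem_Ioc, mem_Ico]
      constructor <;> rintro ⟨h, h'⟩ <;> constructor <;> linarith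
    simp only [indicator_apply, e1]
    congr 1
    rw [← mul_assoc, ← ENNReal.ofReal_mul (Real.exp_pos _).le, ← Real.exp_add]
    congr 4
    ring

/-- `𝔼_1(Z_t s^{Z_t})`. -/
noncomputable def meanZ (t s : ℝ) : ℝ≥0∞ := ∫⁻ τ, (Z t τ : ℝ≥0∞) * weight s (Z t τ) ∂law μ 1

/-- `𝔼_1(Z_t (Z_t - 1) s^{Z_t})`. -/
noncomputable def meanNumPairs (t s : ℝ) : ℝ≥0∞ :=
  ∫⁻ τ, (numPairs (Z t τ) : ℝ≥0∞) * weight s (Z t τ) ∂law μ 1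

/-- The mean, weighted by `s^{Z_t}`, of the number of ordered pairs of distinct individuals extant
at time `t` which have a common ancestor at time `t - b`. -/
noncomputable def meanPairs (b t s : ℝ) : ℝ≥0∞ :=
  ∫⁻ τ, ((pairs (t - b) t τ).encard : ℝ≥0∞) * weight s (Z t τ) ∂law μ 1

lemma egf_renewal {s : ℝ} (hs : 0 ≤ s) {t : ℝ} (ht : 0 ≤ t) :
    ENNReal.ofReal (Real.exp (μ.real univ * t)) * egf μ t s = ENNReal.ofReal s +
      ∫⁻ v in Ioc 0 t, ENNReal.ofReal (Real.exp (μ.real univ * v)) *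
        ∑' k, μ {k} * egf μ v s ^ k := by
  have h := lintegral_renewal μ le_rfl (weight s) (F := fun k t ω => weight s (Z t ω))
    (fun k => (Measurable.of_discrete (f := weight s)).comp measurable_Z_prod)
    (fun τ t _ _ => rfl) (fun τ t _ h => by rw [Z_of_le (by simpa using h)]) ht
  rw [lintegral_comp_Z_zero, weight_one] at h
  simp only [lintegral_weight_Z μ hs] at h
  rw [pow_one] at h
  rw [h, renewal_change_time (fun v => ∑' k, μ {k} * egf μ v s ^ k)]
  simp

lemma lintegral_Z_mul_weight {s : ℝ} (hs : 0 ≤ s) (x : ℕ) (t : ℝ) :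
    ∫⁻ ω, (Z t ω : ℝ≥0∞) * weight s (Z t ω) ∂law μ x =
      x * egf μ t s ^ (x - 1) * meanZ μ t s := by
  rw [meanZ, ← lintegral_sum_mul_weight_Z μ hs x t (B := fun τ => (Z t τ : ℝ≥0∞))
    ((Measurable.of_discrete (f := fun z : ℕ∞ => (z : ℝ≥0∞))).comp (measurable_Z t))]
  simp only [← toENNReal_sum, ← Z_eq_sum]

lemma measurable_encard_pairs_at (r t : ℝ) :
    Measurable fun ω : Tree x => ((pairs (t - r) t ω).encard : ℝ≥0∞) := by
  have h := (measurable_encard_pairs (x := x) r).comp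
    (measurable_prodMk_left (x := t) (β := Tree x))
  simp only [Function.comp_def] at h
  exact Measurable.comp (g := fun z : ℕ∞ => (z : ℝ≥0∞)) Measurable.of_discrete h

lemma lintegral_pairs_mul_weight {s : ℝ} (hs : 0 ≤ s) (x : ℕ) (b t : ℝ) :
    ∫⁻ ω, ((pairs (t - b) t ω).encard : ℝ≥0∞) * weight s (Z t ω) ∂law μ x =
      x * egf μ t s ^ (x - 1) * meanPairs μ b t s := by
  rw [meanPairs, ← lintegral_sum_mul_weight_Z μ hs x t
    (B := fun τ => ((pairs (t - b) t τ).encard : ℝ≥0∞)) (measurable_encard_pairs_at b t)]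
  simp only [← toENNReal_sum, ← encard_pairs_eq_sum]

lemma meanZ_renewal {s : ℝ} (hs : 0 ≤ s) {t : ℝ} (ht : 0 ≤ t) :
    ENNReal.ofReal (Real.exp (μ.real univ * t)) * meanZ μ t s = ENNReal.ofReal s +
      ∫⁻ v in Ioc 0 t, ENNReal.ofReal (Real.exp (μ.real univ * v)) *
        ∑' k, μ {k} * (k * egf μ v s ^ (k - 1) * meanZ μ v s) := by
  have h := lintegral_renewal μ le_rfl (fun z => (z : ℝ≥0∞) * weight s z)
    (F := fun k t ω => (Z t ω : ℝ≥0∞) * weight s (Z t ω))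
    (fun k => (Measurable.of_discrete (f := fun z : ℕ∞ => (z : ℝ≥0∞) * weight s z)).comp
      measurable_Z_prod)
    (fun τ t _ _ => rfl) (fun τ t _ h => by rw [Z_of_le (by simpa using h)]) ht
  rw [lintegral_comp_Z_zero μ (fun z => (z : ℝ≥0∞) * weight s z)] at h
  simp only [lintegral_Z_mul_weight μ hs] at h
  simp only [Nat.cast_one, Nat.sub_self, pow_zero, one_mul, ENat.toENNReal_one,
    weight_one] at h
  rw [h, renewal_change_time (fun v => ∑' k, μ {k} * (k * egf μ v s ^ (k - 1) * meanZ μ v s))]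
  simp

lemma offDiag_mul_weight {β : Type*} (S : Set β) (s : ℝ) :
    (S.offDiag.encard : ℝ≥0∞) * weight s S.encard =
      (numPairs S.encard : ℝ≥0∞) * weight s S.encard := by
  rcases S.finite_or_infinite with h | h
  · rw [encard_offDiag h]
  · rw [h.encard_eq]
    simp

/-- A founder living beyond `t - b` makes every pair count, whence the initial value; otherwise the
pairs are those of the children's forest, both times being shifted alike so that the gap `b`
persists. -/
lemma meanPairs_renewal {s : ℝ} (hs : 0 ≤ s) {b t : ℝ} (hb : 0 ≤ b) (ht : b ≤ t) :
    ENNReal.ofReal (Real.exp (μ.real univ * t)) * meanPairs μ b t s =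
      ENNReal.ofReal (Real.exp (μ.real univ * b)) * meanNumPairs μ b s +
      ∫⁻ v in Ioc b t, ENNReal.ofReal (Real.exp (μ.real univ * v)) *
        ∑' k, μ {k} * (k * egf μ v s ^ (k - 1) * meanPairs μ b v s) := by
  have h := lintegral_renewal μ hb (fun z => (numPairs z : ℝ≥0∞) * weight s z)
    (F := fun k t ω => ((pairs (t - b) t ω).encard : ℝ≥0∞) * weight s (Z t ω))
    (fun k => ((Measurable.of_discrete (f := fun z : ℕ∞ => (z : ℝ≥0∞))).comp
      (measurable_encard_pairs b)).mul
        ((Measurable.of_discrete (f := weight s)).comp measurable_Z_prod))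
    (fun τ t h1 h2 => by
      rw [pairs_of_lt (sub_nonneg.2 h1) h2]
      exact offDiag_mul_weight (alive τ t) s)
    (fun τ t h1 h2 => by
      rw [encard_pairs_of_le h2 (by linarith), Z_of_le (by linarith), sub_right_comm]) ht
  simp only [lintegral_pairs_mul_weight μ hs] at h
  simp only [Nat.cast_one, Nat.sub_self, pow_zero, one_mul] at h
  rw [h, renewal_change_time (fun v => ∑' k, μ {k} * (k * egf μ v s ^ (k - 1) * meanPairs μ b v s))]
  rfl

end

section

/-! ### Integral equations on a half-line -/

/-- Freezing `f` at its value at `b` to the left of `b` gives a function on the whole line, to which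
the two-sided fundamental theorem of calculus applies. -/
lemma continuous_extend {b : ℝ} {f : ℝ → ℝ} (hf : ContinuousOn f (Ici b)) :
    Continuous fun t => f (max t b) :=
  hf.comp_continuous (continuous_id.max continuous_const) fun t => le_max_right t b

lemma integral_extend {b t : ℝ} (ht : b ≤ t) (f : ℝ → ℝ) :
    ∫ v in b..t, f (max v b) = ∫ v in b..t, f v := by
  refine intervalIntegral.integral_congr fun v hv => ?_
  rw [uIcc_of_le ht] at hv
  simp only [max_eq_left hv.1]

lemma continuousOn_of_integral_eq {b y₀ : ℝ} {y f : ℝ → ℝ}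
    (hf : ∀ t, b ≤ t → IntervalIntegrable f volume b t)
    (h : ∀ t, b ≤ t → y t = y₀ + ∫ v in b..t, f v) : ContinuousOn y (Ici b) := by
  have hf' : ∀ t, IntervalIntegrable (fun v => f (max v b)) volume b t := by
    intro t
    rcases le_total b t with ht | ht
    · refine (hf t ht).congr_ae ?_
      refine (ae_restrict_mem measurableSet_uIoc).mono fun v hv => ?_
      rw [uIoc_of_le ht] at hv
      simp only [max_eq_left hv.1.le]
    · refine (intervalIntegrable_const (c := f b)).congr_ae ?_
      refine (ae_restrict_mem measurableSet_uIoc).mono fun v hv => ?_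
      rw [uIoc_of_ge ht] at hv
      simp only [max_eq_right hv.2]
  have hc : Continuous fun t => y₀ + ∫ v in b..t, f (max v b) :=
    continuous_const.add (intervalIntegral.continuous_primitive
      (fun p q => (hf' p).symm.trans (hf' q)) b)
  refine hc.continuousOn.congr fun t ht => ?_
  simp only [h t ht, integral_extend ht]

lemma hasDerivWithinAt_of_integral_eq {b y₀ : ℝ} {y f : ℝ → ℝ} (hf : ContinuousOn f (Ici b))
    (h : ∀ t, b ≤ t → y t = y₀ + ∫ v in b..t, f v) {t : ℝ} (ht : b ≤ t) :
    HasDerivWithinAt y (f t) (Ici b) t := by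
  have hc := continuous_extend hf
  have hd : HasDerivAt (fun t => y₀ + ∫ v in b..t, f (max v b)) (f (max t b)) t :=
    (hc.integral_hasStrictDerivAt b t).hasDerivAt.const_add y₀
  rw [max_eq_left ht] at hd
  refine hd.hasDerivWithinAt.congr (fun u hu => ?_) ?_
  · rw [h u hu, integral_extend hu]
  · rw [h t ht, integral_extend ht]

/-- Bootstrapping: a locally bounded measurable solution is continuous, being a primitive, hence
differentiable, and then `y · exp(-∫β)` has zero derivative. -/
lemma eq_mul_exp_of_integral_eq {b y₀ : ℝ} {y β : ℝ → ℝ} (hβ : ContinuousOn β (Ici b))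
    (hy : Measurable y) (hM : ∀ t, b ≤ t → ∃ M, ∀ v ∈ Icc b t, |y v| ≤ M)
    (h : ∀ t, b ≤ t → y t = y₀ + ∫ v in b..t, β v * y v) {t : ℝ} (ht : b ≤ t) :
    y t = y₀ * Real.exp (∫ v in b..t, β v) := by
  have hi : ∀ t, b ≤ t → IntervalIntegrable (fun v => β v * y v) volume b t := by
    intro t ht
    obtain ⟨M, hM⟩ := hM t ht
    have hyi : IntervalIntegrable y volume b t := by
      rw [intervalIntegrable_iff_integrableOn_Icc_of_le ht]
      refine Measure.integrableOn_of_bounded (M := M) (by simp) hy.aestronglyMeasurable ?_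
      exact (ae_restrict_mem measurableSet_Icc).mono fun v hv => hM v hv
    refine hyi.continuousOn_mul ?_
    rw [uIcc_of_le ht]
    exact hβ.mono Icc_subset_Ici_self
  have hyc : ContinuousOn y (Ici b) := continuousOn_of_integral_eq hi h
  have hyd : ∀ t, b ≤ t → HasDerivWithinAt y (β t * y t) (Ici b) t := fun t ht =>
    hasDerivWithinAt_of_integral_eq (hβ.mul hyc) h ht
  have hBd : ∀ t, b ≤ t → HasDerivWithinAt (fun t => ∫ v in b..t, β v) (β t) (Ici b) t :=
    fun t ht => hasDerivWithinAt_of_integral_eq (y₀ := 0) hβ (fun t _ => (zero_add _).symm) ht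
  have hD : ∀ t, b ≤ t →
      HasDerivWithinAt (fun t => y t * Real.exp (-∫ v in b..t, β v)) 0 (Ici b) t := by
    intro t ht
    have := (hyd t ht).mul (hBd t ht).neg.exp
    refine this.congr_deriv ?_
    ring
  have hconst := constant_of_has_deriv_right_zero
    (f := fun t => y t * Real.exp (-∫ v in b..t, β v)) (a := b) (b := t)
    (fun u hu => ((hD u hu.1).continuousWithinAt).mono Icc_subset_Ici_self)
    (fun u hu => (hD u hu.1).mono (Ici_subset_Ici.2 hu.1)) t (right_mem_Icc.2 ht)
  have hb : y b = y₀ := by simpa using h b le_rfl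
  simp only [intervalIntegral.integral_same, neg_zero, Real.exp_zero, mul_one, hb] at hconst
  rw [← hconst, mul_assoc, ← Real.exp_add]
  simp

lemma toReal_setLIntegral_exp_mul {c b t : ℝ} (hbt : b ≤ t) {R : ℝ → ℝ≥0∞} (hR : Measurable R)
    (hfin : ∀ v, b ≤ v → R v ≠ ⊤) :
    (∫⁻ v in Ioc b t, ENNReal.ofReal (Real.exp (c * v)) * R v).toReal =
      ∫ v in b..t, Real.exp (c * v) * (R v).toReal := by
  rw [intervalIntegral.integral_of_le hbt, ← integral_toReal]
  · simp only [ENNReal.toReal_mul, ENNReal.toReal_ofReal (Real.exp_pos _).le]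
  · exact (Measurable.mul (by fun_prop) hR).aemeasurable
  · refine (ae_restrict_mem measurableSet_Ioc).mono fun v hv => ?_
    exact ENNReal.mul_lt_top ENNReal.ofReal_lt_top (hfin v hv.1.le).lt_top

/-! ### The generating function -/

variable (μ : Measure ℕ) [IsFiniteMeasure μ] [NeZero μ]

lemma weight_le_one {s : ℝ} (hs : s ∈ Icc (0 : ℝ) 1) (z : ℕ∞) : weight s z ≤ 1 := by
  induction z using ENat.recTopCoe with
  | top => simp
  | coe n =>
    rw [weight_coe]
    exact ENNReal.ofReal_le_one.2 (pow_le_one₀ hs.1 hs.2)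

lemma egf_le_one (t : ℝ) {s : ℝ} (hs : s ∈ Icc (0 : ℝ) 1) : egf μ t s ≤ 1 := by
  calc egf μ t s ≤ ∫⁻ _, 1 ∂law μ 1 := lintegral_mono fun τ => weight_le_one hs _
    _ = 1 := by simp

lemma toReal_lintegral_weight {s : ℝ} (hs : 0 ≤ s) (x : ℕ) (t : ℝ) :
    genFun μ x t s = (∫⁻ ω, weight s (Z t ω) ∂law μ x).toReal := by
  have hm : MeasurableSet {ω : Tree x | Z t ω < ⊤} :=
    measurable_Z t (MeasurableSet.of_discrete (s := Iio ⊤))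
  have hm' : Measurable fun ω : Tree x => s ^ (Z t ω).toNat :=
    (Measurable.of_discrete (f := fun z : ℕ∞ => s ^ z.toNat)).comp (measurable_Z t)
  rw [genFun, integral_eq_lintegral_of_nonneg_ae
    (Filter.Eventually.of_forall fun ω => pow_nonneg hs _) hm'.aestronglyMeasurable]
  congr 1
  rw [← lintegral_indicator hm]
  refine lintegral_congr fun ω => ?_
  simp only [indicator_apply, mem_ofPred_eq, weight, lt_top_iff_ne_top, ite_not]

lemma psi_eq {s : ℝ} (hs : 0 ≤ s) (t : ℝ) : psi μ t s = (egf μ t s).toReal :=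
  toReal_lintegral_weight μ hs 1 t

lemma genFun_eq_pow {s : ℝ} (hs : 0 ≤ s) (x : ℕ) (t : ℝ) :
    genFun μ x t s = psi μ t s ^ x := by
  rw [toReal_lintegral_weight μ hs, lintegral_weight_Z μ hs, ENNReal.toReal_pow, psi_eq μ hs]

lemma psi_mem_Icc (t : ℝ) {s : ℝ} (hs : s ∈ Icc (0 : ℝ) 1) : psi μ t s ∈ Icc (0 : ℝ) 1 := by
  rw [psi_eq μ hs.1]
  exact ⟨ENNReal.toReal_nonneg, ENNReal.toReal_le_of_le_ofReal zero_le_one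
    (by simpa using egf_le_one μ t hs)⟩

lemma measurable_lintegral_law {F : ℝ → Tree 1 → ℝ≥0∞}
    (hF : Measurable fun p : ℝ × Tree 1 => F p.1 p.2) :
    Measurable fun t => ∫⁻ τ, F t τ ∂law μ 1 :=
  Measurable.lintegral_prod_right' (f := fun p : ℝ × Tree 1 => F p.1 p.2) hF

lemma measurable_egf (s : ℝ) : Measurable fun t => egf μ t s :=
  measurable_lintegral_law μ
    ((Measurable.of_discrete (f := weight s)).comp measurable_Z_prod)

lemma measurable_meanZ (s : ℝ) : Measurable fun t => meanZ μ t s :=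
  measurable_lintegral_law μ
    ((Measurable.of_discrete (f := fun z : ℕ∞ => (z : ℝ≥0∞) * weight s z)).comp measurable_Z_prod)

lemma measurable_meanPairs (b s : ℝ) : Measurable fun t => meanPairs μ b t s :=
  measurable_lintegral_law μ
    (((Measurable.of_discrete (f := fun z : ℕ∞ => (z : ℝ≥0∞))).comp
      (measurable_encard_pairs b)).mul
        ((Measurable.of_discrete (f := weight s)).comp measurable_Z_prod))

lemma tsum_measure_singleton (ν : Measure ℕ) : ∑' k, ν {k} = ν univ := by
  have := lintegral_countable' (μ := ν) (fun _ => 1)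
  simpa using this.symm

end

/-! ### Power series of the offspring measure and the equation for the generating function -/

section

/-- `∑ₖ yᵏ μ(k)`. -/
noncomputable def genMu (μ : Measure ℕ) (y : ℝ) : ℝ := ∑' k, μ.real {k} * y ^ k

/-- `∑ₖ k yᵏ⁻¹ μ(k)`. -/
noncomputable def genMuDeriv (μ : Measure ℕ) (y : ℝ) : ℝ := ∑' k : ℕ, μ.real {k} * (k * y ^ (k - 1))

variable (μ : Measure ℕ) [IsFiniteMeasure μ]

lemma hasSum_measureReal_singleton : HasSum (fun k => μ.real {k}) (μ.real univ) := by
  have h : ∑' k, μ {k} ≠ ⊤ := by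
    rw [tsum_measure_singleton]
    exact measure_ne_top _ _
  have := (ENNReal.summable_toReal h).hasSum
  rwa [← ENNReal.tsum_toReal_eq (fun k => measure_ne_top _ _), tsum_measure_singleton] at this

lemma continuousOn_genMu : ContinuousOn (genMu μ) (Icc 0 1) := by
  refine continuousOn_tsum (fun k => by fun_prop) (hasSum_measureReal_singleton μ).summable ?_
  intro k y hy
  rw [Real.norm_eq_abs, abs_of_nonneg (by have := hy.1; positivity)]
  exact mul_le_of_le_one_right measureReal_nonneg (pow_le_one₀ hy.1 hy.2)

lemma summable_natCast_mul_pow_pred {ρ : ℝ} (h0 : 0 ≤ ρ) (h1 : ρ < 1) :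
    Summable fun k : ℕ => (k : ℝ) * ρ ^ (k - 1) := by
  rw [← summable_nat_add_iff 1]
  have h2 := (summable_pow_mul_geometric_of_norm_lt_one 1 (r := ρ)
    (by rwa [Real.norm_eq_abs, abs_of_nonneg h0])).add (summable_geometric_of_lt_one h0 h1)
  refine h2.congr fun k => ?_
  simp only [Nat.add_sub_cancel, Nat.cast_add, Nat.cast_one, pow_one]
  ring

lemma measureReal_singleton_le (k : ℕ) : μ.real {k} ≤ μ.real univ :=
  measureReal_mono (subset_univ _)

lemma summable_genMuDeriv {ρ : ℝ} (h0 : 0 ≤ ρ) (h1 : ρ < 1) :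
    Summable fun k : ℕ => μ.real {k} * (k * ρ ^ (k - 1)) := by
  refine Summable.of_nonneg_of_le (fun k => by positivity) (fun k => ?_)
    ((summable_natCast_mul_pow_pred h0 h1).mul_left (μ.real univ))
  exact mul_le_mul_of_nonneg_right (measureReal_singleton_le μ k) (by positivity)

/-- The point `1` is left out because `μ` may have infinite mean; near `y < 1` the series is
dominated by its value at some `ρ` in `(y, 1)`. -/
lemma continuousOn_genMuDeriv : ContinuousOn (genMuDeriv μ) (Ico 0 1) := by
  refine continuousOn_of_locally_continuousOn fun y hy => ?_
  obtain ⟨ρ, hyρ, hρ⟩ := exists_between hy.2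
  refine ⟨Iio ρ, isOpen_Iio, hyρ, ?_⟩
  refine continuousOn_tsum (fun k => by fun_prop)
    (summable_genMuDeriv μ (hy.1.trans hyρ.le) hρ) ?_
  rintro k z ⟨hz, hzρ⟩
  have hz0 := hz.1
  rw [Real.norm_eq_abs, abs_of_nonneg (by positivity)]
  exact mul_le_mul_of_nonneg_left (mul_le_mul_of_nonneg_left
    (pow_le_pow_left₀ hz0 (le_of_lt hzρ) _) (Nat.cast_nonneg k)) measureReal_nonneg

lemma summable_genMu {y : ℝ} (hy : y ∈ Icc (0 : ℝ) 1) : Summable fun k => μ.real {k} * y ^ k :=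
  Summable.of_nonneg_of_le (fun k => by have := hy.1; positivity)
    (fun _ => mul_le_of_le_one_right measureReal_nonneg (pow_le_one₀ hy.1 hy.2))
    (hasSum_measureReal_singleton μ).summable

lemma genMu_mem_Icc {y : ℝ} (hy : y ∈ Icc (0 : ℝ) 1) : genMu μ y ∈ Icc 0 (μ.real univ) := by
  refine ⟨tsum_nonneg fun k => by have := hy.1; positivity, ?_⟩
  rw [← (hasSum_measureReal_singleton μ).tsum_eq]
  exact (summable_genMu μ hy).tsum_le_tsum
    (fun _ => mul_le_of_le_one_right measureReal_nonneg (pow_le_one₀ hy.1 hy.2))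
    (hasSum_measureReal_singleton μ).summable

lemma Phi_eq {y : ℝ} (hy : y ∈ Icc (0 : ℝ) 1) : Phi μ y = genMu μ y - μ.real univ * y := by
  have h := (summable_genMu μ hy).hasSum.sub ((hasSum_measureReal_singleton μ).mul_right y)
  rw [genMu, ← h.tsum_eq, Phi]
  exact tsum_congr fun k => by ring

variable [NeZero μ]

lemma egf_ne_top (t : ℝ) {s : ℝ} (hs : s ∈ Icc (0 : ℝ) 1) : egf μ t s ≠ ⊤ :=
  ne_top_of_le_ne_top ENNReal.one_ne_top (egf_le_one μ t hs)

lemma tsum_mul_egf_pow_ne_top (t : ℝ) {s : ℝ} (hs : s ∈ Icc (0 : ℝ) 1) :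
    ∑' k, μ {k} * egf μ t s ^ k ≠ ⊤ := by
  refine ne_top_of_le_ne_top (b := μ univ) (measure_ne_top _ _) ?_
  rw [← tsum_measure_singleton μ]
  exact ENNReal.tsum_le_tsum fun k => mul_le_of_le_one_right' (pow_le_one' (egf_le_one μ t hs) k)

lemma toReal_tsum_mul_egf_pow (t : ℝ) {s : ℝ} (hs : s ∈ Icc (0 : ℝ) 1) :
    (∑' k, μ {k} * egf μ t s ^ k).toReal = genMu μ (psi μ t s) := by
  rw [ENNReal.tsum_toReal_eq, genMu]
  · refine tsum_congr fun k => ?_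
    rw [ENNReal.toReal_mul, ENNReal.toReal_pow, psi_eq μ hs.1]
    rfl
  · exact fun k => ENNReal.mul_ne_top (measure_ne_top _ _) (ENNReal.pow_ne_top (egf_ne_top μ t hs))

lemma exp_mul_psi {s : ℝ} (hs : s ∈ Icc (0 : ℝ) 1) {t : ℝ} (ht : 0 ≤ t) :
    Real.exp (μ.real univ * t) * psi μ t s =
      s + ∫ v in 0..t, Real.exp (μ.real univ * v) * genMu μ (psi μ v s) := by
  have h := congrArg ENNReal.toReal (egf_renewal μ hs.1 ht)
  have hfin : ENNReal.ofReal (Real.exp (μ.real univ * t)) * egf μ t s ≠ ⊤ :=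
    ENNReal.mul_ne_top ENNReal.ofReal_ne_top (egf_ne_top μ t hs)
  rw [egf_renewal μ hs.1 ht] at hfin
  have hm : Measurable fun v => ∑' k, μ {k} * egf μ v s ^ k :=
    Measurable.tsum fun k => ((measurable_egf μ s).pow_const k).const_mul _
  rw [ENNReal.toReal_mul, ENNReal.toReal_ofReal (Real.exp_pos _).le, ← psi_eq μ hs.1,
    ENNReal.toReal_add (ENNReal.add_ne_top.1 hfin).1 (ENNReal.add_ne_top.1 hfin).2,
    ENNReal.toReal_ofReal hs.1, toReal_setLIntegral_exp_mul ht hm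
      (fun v _ => tsum_mul_egf_pow_ne_top μ v hs)] at h
  simpa only [toReal_tsum_mul_egf_pow μ _ hs] using h

lemma psi_zero {s : ℝ} (hs : s ∈ Icc (0 : ℝ) 1) : psi μ 0 s = s := by
  simpa using exp_mul_psi μ hs le_rfl

lemma continuousOn_psi_left {s : ℝ} (hs : s ∈ Icc (0 : ℝ) 1) :
    ContinuousOn (fun t => psi μ t s) (Ici 0) := by
  have h : ContinuousOn (fun t => Real.exp (μ.real univ * t) * psi μ t s) (Ici 0) := by
    refine continuousOn_of_integral_eq (fun t ht => ?_) (fun t ht => exp_mul_psi μ hs ht)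
    rw [intervalIntegrable_iff_integrableOn_Icc_of_le ht]
    have hm : Measurable fun v => genMu μ (psi μ v s) := by
      simp only [← toReal_tsum_mul_egf_pow μ _ hs]
      exact (Measurable.tsum
        fun k => ((measurable_egf μ s).pow_const k).const_mul _).ennreal_toReal
    refine IntegrableOn.continuousOn_mul (by fun_prop) ?_ isCompact_Icc
    refine Measure.integrableOn_of_bounded (M := μ.real univ) (by simp) hm.aestronglyMeasurable ?_
    refine Filter.Eventually.of_forall fun v => ?_
    have := genMu_mem_Icc μ (psi_mem_Icc μ v hs)
    rw [Real.norm_eq_abs, abs_of_nonneg this.1]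
    exact this.2
  have h2 : ContinuousOn (fun t => Real.exp (-(μ.real univ * t)) *
      (Real.exp (μ.real univ * t) * psi μ t s)) (Ici 0) :=
    ContinuousOn.mul (by fun_prop) h
  refine h2.congr fun t _ => ?_
  simp only [← mul_assoc, ← Real.exp_add]
  simp

lemma hasDerivWithinAt_psi_left {s : ℝ} (hs : s ∈ Icc (0 : ℝ) 1) {t : ℝ} (ht : 0 ≤ t) :
    HasDerivWithinAt (fun r => psi μ r s) (Phi μ (psi μ t s)) (Ici 0) t := by
  have hg : ContinuousOn (fun v => Real.exp (μ.real univ * v) * genMu μ (psi μ v s)) (Ici 0) :=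
    ContinuousOn.mul (by fun_prop) ((continuousOn_genMu μ).comp (continuousOn_psi_left μ hs)
      fun v _ => psi_mem_Icc μ v hs)
  have h1 := hasDerivWithinAt_of_integral_eq hg (fun t ht => exp_mul_psi μ hs ht) ht
  have h2 : HasDerivWithinAt (fun t => Real.exp (-(μ.real univ * t)))
      (Real.exp (-(μ.real univ * t)) * -(μ.real univ * 1)) (Ici 0) t :=
    (((hasDerivAt_id t).const_mul (μ.real univ)).neg.exp).hasDerivWithinAt
  have h3 := h2.mul h1
  have e : ∀ r, Real.exp (-(μ.real univ * r)) * Real.exp (μ.real univ * r) = 1 := fun r => by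
    rw [← Real.exp_add]; simp
  refine (h3.congr (fun r _ => ?_) ?_).congr_deriv ?_
  · simp only [Pi.mul_apply, ← mul_assoc, e, one_mul]
  · simp only [Pi.mul_apply, ← mul_assoc, e, one_mul]
  · rw [Phi_eq μ (psi_mem_Icc μ t hs)]
    linear_combination (genMu μ (psi μ t s) - μ.real univ * psi μ t s) * e t

/-- Bounding `genMu` by `c = μ(ℕ)` in the integral equation gives `e^{ct} ψ_t(s) ≤ s + e^{ct} - 1`.
This keeps `ψ_t(s)` where `genMuDeriv` converges and is continuous. -/
lemma psi_lt_one {s : ℝ} (hs : s ∈ Ico (0 : ℝ) 1) {t : ℝ} (ht : 0 ≤ t) : psi μ t s < 1 := by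
  have hs' : s ∈ Icc (0 : ℝ) 1 := ⟨hs.1, hs.2.le⟩
  have h := exp_mul_psi μ hs' ht
  have hg : ContinuousOn (fun v => Real.exp (μ.real univ * v) * genMu μ (psi μ v s)) (Ici 0) :=
    ContinuousOn.mul (by fun_prop) ((continuousOn_genMu μ).comp (continuousOn_psi_left μ hs')
      fun v _ => psi_mem_Icc μ v hs')
  have h1 : ∫ v in 0..t, Real.exp (μ.real univ * v) * genMu μ (psi μ v s) ≤
      ∫ v in 0..t, Real.exp (μ.real univ * v) * μ.real univ := by
    refine intervalIntegral.integral_mono_on ht ?_ ?_ fun v hv => ?_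
    · refine ContinuousOn.intervalIntegrable ?_
      rw [uIcc_of_le ht]
      exact hg.mono Icc_subset_Ici_self
    · exact Continuous.intervalIntegrable (by fun_prop) _ _
    · exact mul_le_mul_of_nonneg_left (genMu_mem_Icc μ (psi_mem_Icc μ v hs')).2 (Real.exp_pos _).le
  have h2 : ∫ v in 0..t, Real.exp (μ.real univ * v) * μ.real univ =
      Real.exp (μ.real univ * t) - 1 := by
    have := intervalIntegral.integral_eq_sub_of_hasDerivAt
      (f := fun v => Real.exp (μ.real univ * v))
      (f' := fun v => Real.exp (μ.real univ * v) * μ.real univ) (a := 0) (b := t)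
      (fun v _ => by simpa using ((hasDerivAt_id v).const_mul (μ.real univ)).exp)
      (Continuous.intervalIntegrable (by fun_prop) _ _)
    simpa using this
  have h3 := Real.exp_pos (μ.real univ * t)
  by_contra hlt
  nlinarith [hs.2]

/-! ### Linear equations -/

lemma exists_forall_mul_weight_le {s : ℝ} (hs : s ∈ Ico (0 : ℝ) 1) (j : ℕ) :
    ∃ M : ℝ, ∀ z : ℕ∞, ((z : ℝ≥0∞)) ^ j * weight s z ≤ ENNReal.ofReal M := by
  obtain ⟨M, hM⟩ := (tendsto_pow_const_mul_const_pow_of_lt_one j hs.1 hs.2).bddAbove_range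
  refine ⟨M, fun z => ?_⟩
  induction z using ENat.recTopCoe with
  | top => simp
  | coe n =>
    rw [weight_coe, ENat.toENNReal_coe, ← ENNReal.ofReal_natCast,
      ← ENNReal.ofReal_pow (Nat.cast_nonneg n), ← ENNReal.ofReal_mul (by positivity)]
    exact ENNReal.ofReal_le_ofReal (hM ⟨n, rfl⟩)

lemma exists_meanZ_le {s : ℝ} (hs : s ∈ Ico (0 : ℝ) 1) :
    ∃ M : ℝ, ∀ t, meanZ μ t s ≤ ENNReal.ofReal M := by
  obtain ⟨M, hM⟩ := exists_forall_mul_weight_le hs 1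
  refine ⟨M, fun t => ?_⟩
  calc meanZ μ t s ≤ ∫⁻ _, ENNReal.ofReal M ∂law μ 1 :=
        lintegral_mono fun τ => by simpa using hM (Z t τ)
    _ = ENNReal.ofReal M := by simp

lemma numPairs_le (z : ℕ∞) : (numPairs z : ℝ≥0∞) ≤ (z : ℝ≥0∞) ^ 2 := by
  rw [← ENat.toENNReal_pow, ENat.toENNReal_le, numPairs, sq]
  exact mul_le_mul_right tsub_le_self z

lemma exists_meanPairs_le {s : ℝ} (hs : s ∈ Ico (0 : ℝ) 1) :
    ∃ M : ℝ, ∀ b t, meanPairs μ b t s ≤ ENNReal.ofReal M ∧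
      meanNumPairs μ t s ≤ ENNReal.ofReal M := by
  obtain ⟨M, hM⟩ := exists_forall_mul_weight_le hs 2
  have h1 : ∀ z : ℕ∞, (numPairs z : ℝ≥0∞) * weight s z ≤ ENNReal.ofReal M := fun z =>
    (mul_le_mul_left (numPairs_le z) _).trans (hM z)
  refine ⟨M, fun b t => ⟨?_, ?_⟩⟩
  · calc meanPairs μ b t s ≤ ∫⁻ _, ENNReal.ofReal M ∂law μ 1 := by
          refine lintegral_mono fun τ => ?_
          refine le_trans (mul_le_mul_left (ENat.toENNReal_mono
            (encard_le_encard (t := (alive τ t).offDiag) fun p hp => hp.1)) _) ?_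
          exact (offDiag_mul_weight (alive τ t) s).trans_le (h1 _)
      _ = ENNReal.ofReal M := by simp
  · calc meanNumPairs μ t s ≤ ∫⁻ _, ENNReal.ofReal M ∂law μ 1 :=
          lintegral_mono fun τ => h1 _
      _ = ENNReal.ofReal M := by simp

lemma tsum_natCast_mul_egf_pow_ne_top {t : ℝ} (ht : 0 ≤ t) {s : ℝ} (hs : s ∈ Ico (0 : ℝ) 1) :
    (∑' k : ℕ, μ {k} * (k * egf μ t s ^ (k - 1))) ≠ ⊤ ∧
    (∑' k : ℕ, μ {k} * (k * egf μ t s ^ (k - 1))).toReal = genMuDeriv μ (psi μ t s) := by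
  have hs' : s ∈ Icc (0 : ℝ) 1 := ⟨hs.1, hs.2.le⟩
  have h0 := (psi_mem_Icc μ t hs').1
  have e : ∀ k : ℕ, μ {k} * (k * egf μ t s ^ (k - 1)) =
      ENNReal.ofReal (μ.real {k} * (k * psi μ t s ^ (k - 1))) := by
    intro k
    rw [ENNReal.ofReal_mul measureReal_nonneg, ENNReal.ofReal_mul (Nat.cast_nonneg k),
      ENNReal.ofReal_pow h0, ofReal_measureReal, ENNReal.ofReal_natCast, psi_eq μ hs.1,
      ENNReal.ofReal_toReal (egf_ne_top μ t hs')]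
  have h1 := summable_genMuDeriv μ h0 (psi_lt_one μ hs ht)
  simp only [e]
  rw [← ENNReal.ofReal_tsum_of_nonneg (fun k => by positivity) h1]
  exact ⟨ENNReal.ofReal_ne_top, ENNReal.toReal_ofReal (tsum_nonneg fun k => by positivity)⟩

/-- The children's sum is linear in `Y`, with coefficient `genMuDeriv μ (psi μ v s)` independent of
which functional `Y` represents. -/
lemma eq_mul_exp_of_renewal {s : ℝ} (hs : s ∈ Ico (0 : ℝ) 1) {b : ℝ} (hb : 0 ≤ b) {C : ℝ≥0∞}
    {Y : ℝ → ℝ≥0∞} (hY : Measurable Y) {M : ℝ} (hM : ∀ t, Y t ≤ ENNReal.ofReal M)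
    (h : ∀ t, b ≤ t → ENNReal.ofReal (Real.exp (μ.real univ * t)) * Y t = C +
      ∫⁻ v in Ioc b t, ENNReal.ofReal (Real.exp (μ.real univ * v)) *
        ∑' k, μ {k} * (k * egf μ v s ^ (k - 1) * Y v)) {t : ℝ} (ht : b ≤ t) :
    Real.exp (μ.real univ * t) * (Y t).toReal =
      C.toReal * Real.exp (∫ v in b..t, genMuDeriv μ (psi μ v s)) := by
  have hs' : s ∈ Icc (0 : ℝ) 1 := ⟨hs.1, hs.2.le⟩
  have hYt : ∀ t, Y t ≠ ⊤ := fun t => ne_top_of_le_ne_top ENNReal.ofReal_ne_top (hM t)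
  have e : ∀ v, ∑' k, μ {k} * (k * egf μ v s ^ (k - 1) * Y v) =
      (∑' k : ℕ, μ {k} * (k * egf μ v s ^ (k - 1))) * Y v := by
    intro v
    rw [← ENNReal.tsum_mul_right]
    exact tsum_congr fun k => by ring
  simp only [e] at h
  have hm : Measurable fun v => (∑' k : ℕ, μ {k} * (k * egf μ v s ^ (k - 1))) * Y v :=
    (Measurable.tsum fun k =>
      (((measurable_egf μ s).pow_const (k - 1)).const_mul _).const_mul _).mul hY
  have hβ : ContinuousOn (fun v => genMuDeriv μ (psi μ v s)) (Ici b) :=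
    ((continuousOn_genMuDeriv μ).comp (continuousOn_psi_left μ hs')
      fun v hv => ⟨(psi_mem_Icc μ v hs').1, psi_lt_one μ hs hv⟩).mono (Ici_subset_Ici.2 hb)
  refine eq_mul_exp_of_integral_eq (y := fun t => Real.exp (μ.real univ * t) * (Y t).toReal) hβ
    ((by fun_prop : Measurable fun t => Real.exp (μ.real univ * t)).mul hY.ennreal_toReal)
    ?_ ?_ ht
  · intro t _
    refine ⟨Real.exp (μ.real univ * t) * max M 0, fun v hv => ?_⟩
    rw [abs_of_nonneg (by positivity)]
    refine mul_le_mul (Real.exp_le_exp.2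
      (mul_le_mul_of_nonneg_left hv.2 measureReal_nonneg)) ?_ ENNReal.toReal_nonneg (Real.exp_pos _).le
    refine ENNReal.toReal_le_of_le_ofReal (le_max_right _ _) ((hM v).trans ?_)
    exact ENNReal.ofReal_le_ofReal (le_max_left _ _)
  · intro t ht
    have h1 := congrArg ENNReal.toReal (h t ht)
    have hfin : ENNReal.ofReal (Real.exp (μ.real univ * t)) * Y t ≠ ⊤ :=
      ENNReal.mul_ne_top ENNReal.ofReal_ne_top (hYt t)
    rw [h t ht] at hfin
    rw [ENNReal.toReal_mul, ENNReal.toReal_ofReal (Real.exp_pos _).le,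
      ENNReal.toReal_add (ENNReal.add_ne_top.1 hfin).1 (ENNReal.add_ne_top.1 hfin).2,
      toReal_setLIntegral_exp_mul ht hm (fun v hv => ENNReal.mul_ne_top
        (tsum_natCast_mul_egf_pow_ne_top μ (hb.trans hv) hs).1 (hYt v))] at h1
    rw [h1]
    congr 1
    refine intervalIntegral.integral_congr fun v hv => ?_
    rw [uIcc_of_le ht] at hv
    simp only [ENNReal.toReal_mul, (tsum_natCast_mul_egf_pow_ne_top μ (hb.trans hv.1) hs).2]
    ring

lemma meanZ_ne_top {s : ℝ} (hs : s ∈ Ico (0 : ℝ) 1) (t : ℝ) : meanZ μ t s ≠ ⊤ := by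
  obtain ⟨M, hM⟩ := exists_meanZ_le μ hs
  exact ne_top_of_le_ne_top ENNReal.ofReal_ne_top (hM t)

lemma meanPairs_ne_top {s : ℝ} (hs : s ∈ Ico (0 : ℝ) 1) (b t : ℝ) : meanPairs μ b t s ≠ ⊤ := by
  obtain ⟨M, hM⟩ := exists_meanPairs_le μ hs
  exact ne_top_of_le_ne_top ENNReal.ofReal_ne_top (hM b t).1

lemma exp_mul_meanZ {s : ℝ} (hs : s ∈ Ico (0 : ℝ) 1) {t : ℝ} (ht : 0 ≤ t) :
    Real.exp (μ.real univ * t) * (meanZ μ t s).toReal =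
      s * Real.exp (∫ v in 0..t, genMuDeriv μ (psi μ v s)) := by
  obtain ⟨M, hM⟩ := exists_meanZ_le μ hs
  have := eq_mul_exp_of_renewal μ hs le_rfl (measurable_meanZ μ s) hM
    (fun t ht => meanZ_renewal μ hs.1 ht) ht
  rwa [ENNReal.toReal_ofReal hs.1] at this

lemma meanZ_toReal_pos {s : ℝ} (hs : s ∈ Ioo (0 : ℝ) 1) {t : ℝ} (ht : 0 ≤ t) :
    0 < (meanZ μ t s).toReal := by
  have h := exp_mul_meanZ μ ⟨hs.1.le, hs.2⟩ ht
  have h1 := Real.exp_pos (μ.real univ * t)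
  have h2 : 0 < s * Real.exp (∫ v in 0..t, genMuDeriv μ (psi μ v s)) :=
    mul_pos hs.1 (Real.exp_pos _)
  rw [← h] at h2
  exact (mul_pos_iff_of_pos_left h1).1 h2

/-- From time `b` on, both means grow by the same exponential factor, so they remain proportional.
The product form avoids dividing by a mean that vanishes at `s = 0`. -/
lemma meanPairs_mul_meanZ {s : ℝ} (hs : s ∈ Ico (0 : ℝ) 1) {b t : ℝ} (hb : 0 ≤ b) (ht : b ≤ t) :
    (meanPairs μ b t s).toReal * (meanZ μ b s).toReal =
      (meanNumPairs μ b s).toReal * (meanZ μ t s).toReal := by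
  have hs' : s ∈ Icc (0 : ℝ) 1 := ⟨hs.1, hs.2.le⟩
  obtain ⟨M, hM⟩ := exists_meanPairs_le μ hs
  have h1 := eq_mul_exp_of_renewal μ hs hb (measurable_meanPairs μ b s) (fun t => (hM b t).1)
    (fun t ht => meanPairs_renewal μ hs.1 hb ht) ht
  rw [ENNReal.toReal_mul, ENNReal.toReal_ofReal (Real.exp_pos _).le] at h1
  have h2 := exp_mul_meanZ μ hs hb
  have h3 := exp_mul_meanZ μ hs (hb.trans ht)
  have hβ : ContinuousOn (fun v => genMuDeriv μ (psi μ v s)) (Ici 0) :=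
    (continuousOn_genMuDeriv μ).comp (continuousOn_psi_left μ hs')
      fun v hv => ⟨(psi_mem_Icc μ v hs').1, psi_lt_one μ hs hv⟩
  have hi : ∀ p q : ℝ, 0 ≤ p → p ≤ q →
      IntervalIntegrable (fun v => genMuDeriv μ (psi μ v s)) volume p q := fun p q hp hpq => by
    refine ContinuousOn.intervalIntegrable ?_
    rw [uIcc_of_le hpq]
    exact hβ.mono fun v hv => hp.trans hv.1
  rw [← intervalIntegral.integral_add_adjacent_intervals (hi 0 b le_rfl hb) (hi b t hb ht),
    Real.exp_add, ← mul_assoc, ← h2] at h3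
  have e : Real.exp (μ.real univ * t) ≠ 0 := (Real.exp_pos _).ne'
  refine mul_left_cancel₀ e ?_
  linear_combination (meanZ μ b s).toReal * h1 - (meanNumPairs μ b s).toReal * h3

end

section

open scoped Topology

/-! ### Derivatives of the generating function -/

variable (μ : Measure ℕ) [IsFiniteMeasure μ] [NeZero μ]

/-- `𝔼_1(Z_t (Z_t - 1) ⋯ (Z_t - k + 1) s^{Z_t - k})`. -/
noncomputable def factorialMean (k : ℕ) (t s : ℝ) : ℝ :=
  ∫ τ in {τ : Tree 1 | Z t τ < ⊤},
    ((Z t τ).toNat.descFactorial k : ℝ) * s ^ ((Z t τ).toNat - k) ∂law μ 1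

lemma exists_descFactorial_mul_pow_le {ρ : ℝ} (h0 : 0 < ρ) (h1 : ρ < 1) (k : ℕ) :
    ∃ M : ℝ, ∀ n : ℕ, (n.descFactorial k : ℝ) * ρ ^ (n - k) ≤ M := by
  obtain ⟨M, hM⟩ := (tendsto_pow_const_mul_const_pow_of_lt_one k h0.le h1).bddAbove_range
  have hM0 : 0 ≤ M := le_trans (by positivity) (hM ⟨0, rfl⟩)
  -- For `n ≥ k` the power `ρ^(n-k)` is `ρ^n / ρ^k`; for `n < k` the descending factorial vanishes,
  -- whatever the truncated exponent.
  refine ⟨M / ρ ^ k, fun n => ?_⟩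
  rcases lt_or_ge n k with h | h
  · rw [Nat.descFactorial_of_lt h]
    simp only [Nat.cast_zero, zero_mul]
    positivity
  · rw [le_div_iff₀ (by positivity), mul_assoc, ← pow_add, Nat.sub_add_cancel h]
    refine le_trans ?_ (hM ⟨n, rfl⟩)
    have : (n.descFactorial k : ℝ) ≤ (n : ℝ) ^ k := by exact_mod_cast Nat.descFactorial_le_pow n k
    exact mul_le_mul_of_nonneg_right this (by positivity)

lemma measurable_comp_Z_toNat (f : ℕ → ℝ) (t : ℝ) :
    Measurable fun τ : Tree 1 => f (Z t τ).toNat :=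
  (Measurable.of_discrete (f := fun z : ℕ∞ => f z.toNat)).comp (measurable_Z t)

lemma hasDerivAt_factorialMean (k : ℕ) (t : ℝ) {s : ℝ} (hs : s ∈ Ioo (0 : ℝ) 1) :
    HasDerivAt (factorialMean μ k t) (factorialMean μ (k + 1) t s) s := by
  obtain ⟨ρ, hsρ, hρ⟩ := exists_between hs.2
  have hρ0 : 0 < ρ := hs.1.trans hsρ
  obtain ⟨M₀, hM₀⟩ := exists_descFactorial_mul_pow_le hρ0 hρ k
  obtain ⟨M, hM⟩ := exists_descFactorial_mul_pow_le hρ0 hρ (k + 1)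
  have hbd : ∀ (j n : ℕ) (y : ℝ), y ∈ Ioo 0 ρ →
      ‖(n.descFactorial j : ℝ) * y ^ (n - j)‖ ≤ (n.descFactorial j : ℝ) * ρ ^ (n - j) := by
    intro j n y hy
    have := hy.1
    rw [Real.norm_eq_abs, abs_of_nonneg (by positivity)]
    exact mul_le_mul_of_nonneg_left (pow_le_pow_left₀ hy.1.le hy.2.le _) (Nat.cast_nonneg _)
  refine (hasDerivAt_integral_of_dominated_loc_of_deriv_le (𝕜 := ℝ) (s := Ioo 0 ρ)
    (bound := fun _ => M)
    (F := fun y (τ : Tree 1) => ((Z t τ).toNat.descFactorial k : ℝ) * y ^ ((Z t τ).toNat - k))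
    (F' := fun y (τ : Tree 1) =>
      ((Z t τ).toNat.descFactorial (k + 1) : ℝ) * y ^ ((Z t τ).toNat - (k + 1)))
    (Ioo_mem_nhds hs.1 hsρ) ?_ ?_ ?_ ?_ (integrable_const M) ?_).2
  · exact Filter.Eventually.of_forall fun y => (measurable_comp_Z_toNat
      (fun n => (n.descFactorial k : ℝ) * y ^ (n - k)) t).aestronglyMeasurable
  · refine Integrable.of_bound (measurable_comp_Z_toNat
      (fun n => (n.descFactorial k : ℝ) * s ^ (n - k)) t).aestronglyMeasurable M₀ ?_
    exact Filter.Eventually.of_forall fun τ => (hbd k _ s ⟨hs.1, hsρ⟩).trans (hM₀ _)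
  · exact (measurable_comp_Z_toNat
      (fun n => (n.descFactorial (k + 1) : ℝ) * s ^ (n - (k + 1))) t).aestronglyMeasurable
  · exact Filter.Eventually.of_forall fun τ y hy => (hbd (k + 1) _ y hy).trans (hM _)
  · refine Filter.Eventually.of_forall fun τ y _ => ?_
    set n := (Z t τ).toNat
    refine ((hasDerivAt_pow (n - k) y).const_mul (n.descFactorial k : ℝ)).congr_deriv ?_
    rw [Nat.descFactorial_succ, Nat.sub_add_eq]
    push_cast
    ring

lemma factorialMean_zero (t : ℝ) : factorialMean μ 0 t = psi μ t := by
  funext s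
  simp [factorialMean, psi, genFun]

lemma hasDerivAt_psi (t : ℝ) {s : ℝ} (hs : s ∈ Ioo (0 : ℝ) 1) :
    HasDerivAt (psi μ t) (factorialMean μ 1 t s) s := by
  rw [← factorialMean_zero]
  exact hasDerivAt_factorialMean μ 0 t hs

lemma deriv_psi (t : ℝ) {s : ℝ} (hs : s ∈ Ioo (0 : ℝ) 1) :
    deriv (psi μ t) s = factorialMean μ 1 t s :=
  (hasDerivAt_psi μ t hs).deriv

lemma deriv_deriv_psi (t : ℝ) {s : ℝ} (hs : s ∈ Ioo (0 : ℝ) 1) :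
    deriv (deriv (psi μ t)) s = factorialMean μ 2 t s := by
  have : deriv (psi μ t) =ᶠ[𝓝 s] factorialMean μ 1 t := by
    filter_upwards [Ioo_mem_nhds hs.1 hs.2] with y hy using deriv_psi μ t hy
  rw [this.deriv_eq]
  exact (hasDerivAt_factorialMean μ 1 t hs).deriv

lemma pow_mul_factorialMean (k : ℕ) (t : ℝ) {s : ℝ} (hs : 0 ≤ s) {f : ℕ∞ → ℝ≥0∞}
    (hf : ∀ n : ℕ, f n = (n.descFactorial k : ℝ≥0∞)) :
    s ^ k * factorialMean μ k t s = (∫⁻ τ, f (Z t τ) * weight s (Z t τ) ∂law μ 1).toReal := by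
  have hm : MeasurableSet {ω : Tree 1 | Z t ω < ⊤} :=
    measurable_Z t (MeasurableSet.of_discrete (s := Iio ⊤))
  have e : ∀ n : ℕ, s ^ k * ((n.descFactorial k : ℝ) * s ^ (n - k)) = n.descFactorial k * s ^ n := by
    intro n
    rcases lt_or_ge n k with h | h
    · simp [Nat.descFactorial_of_lt h]
    · rw [mul_left_comm, ← pow_add, Nat.add_sub_cancel' h]
  rw [factorialMean, ← integral_const_mul]
  simp only [e]
  rw [integral_eq_lintegral_of_nonneg_ae
    (Filter.Eventually.of_forall fun ω => mul_nonneg (Nat.cast_nonneg _) (pow_nonneg hs _))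
    (measurable_comp_Z_toNat (fun n => (n.descFactorial k : ℝ) * s ^ n) t).aestronglyMeasurable]
  congr 1
  rw [← lintegral_indicator hm]
  refine lintegral_congr fun ω => ?_
  simp only [indicator_apply, mem_ofPred_eq]
  by_cases h : Z t ω = ⊤
  · rw [if_neg (by simp [h]), h, weight_top, mul_zero]
  · obtain ⟨n, hn⟩ := ENat.ne_top_iff_exists.1 h
    rw [if_pos (lt_top_iff_ne_top.2 h), ← hn, weight_coe, hf, ENat.toNat_natCast,
      ENNReal.ofReal_mul (Nat.cast_nonneg _), ENNReal.ofReal_natCast]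

lemma mul_deriv_psi (t : ℝ) {s : ℝ} (hs : s ∈ Ioo (0 : ℝ) 1) :
    s * deriv (psi μ t) s = (meanZ μ t s).toReal := by
  rw [deriv_psi μ t hs, ← pow_one s]
  rw [meanZ, ← pow_mul_factorialMean μ 1 t (pow_nonneg hs.1.le 1) (f := fun z => (z : ℝ≥0∞))
    (fun n => by simp)]
  simp

lemma sq_mul_deriv_deriv_psi (t : ℝ) {s : ℝ} (hs : s ∈ Ioo (0 : ℝ) 1) :
    s ^ 2 * deriv (deriv (psi μ t)) s = (meanNumPairs μ t s).toReal := by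
  rw [deriv_deriv_psi μ t hs, meanNumPairs]
  refine pow_mul_factorialMean μ 2 t hs.1.le (f := fun z => (numPairs z : ℝ≥0∞)) fun n => ?_
  simp only [numPairs, ENat.toENNReal_mul, ENat.toENNReal_sub, ENat.toENNReal_coe,
    ENat.toENNReal_one, Nat.descFactorial_succ, Nat.descFactorial_zero]
  push_cast
  ring_nf
  simp [mul_comm]

lemma continuousOn_psi (t : ℝ) : ContinuousOn (psi μ t) (Ioo 0 1) :=
  fun _ hs => (hasDerivAt_psi μ t hs).continuousAt.continuousWithinAt

/-! ### The pair picked at time `t` -/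

lemma lintegral_weight_numPairs (m : ℕ) :
    ∫⁻ s in Ioo (0 : ℝ) 1, ENNReal.ofReal ((1 - s) / s ^ 2) * ENNReal.ofReal (s ^ (m + 2)) =
      (((m + 2) * (m + 1) : ℕ) : ℝ≥0∞)⁻¹ := by
  have h1 : ∫⁻ s in Ioo (0 : ℝ) 1, ENNReal.ofReal ((1 - s) / s ^ 2) * ENNReal.ofReal (s ^ (m + 2)) =
      ∫⁻ s in Ioo (0 : ℝ) 1, ENNReal.ofReal (s ^ m - s ^ (m + 1)) := by
    refine setLIntegral_congr_fun measurableSet_Ioo fun s hs => ?_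
    have := hs.1
    have h2 : 0 ≤ (1 - s) / s ^ 2 := div_nonneg (by linarith [hs.2]) (by positivity)
    rw [← ENNReal.ofReal_mul h2]
    congr 1
    field_simp
    ring
  have h3 : ∫ s in (0 : ℝ)..1, (s ^ m - s ^ (m + 1)) = 1 / (m + 1) - 1 / (m + 2) := by
    rw [intervalIntegral.integral_sub (Continuous.intervalIntegrable (by fun_prop) _ _)
      (Continuous.intervalIntegrable (by fun_prop) _ _), integral_pow, integral_pow]
    push_cast
    simp
    ring
  rw [h1, ← ofReal_integral_eq_lintegral_ofReal]
  · rw [← integral_Ioc_eq_integral_Ioo, ← intervalIntegral.integral_of_le zero_le_one, h3,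
      ← ENNReal.ofReal_natCast, ← ENNReal.ofReal_inv_of_pos (by positivity)]
    congr 1
    push_cast
    field_simp
    ring
  · exact (Continuous.integrableOn_Icc (by fun_prop)).mono_set Ioo_subset_Icc_self
  · refine (ae_restrict_mem measurableSet_Ioo).mono fun s hs => ?_
    have : s ^ (m + 1) ≤ s ^ m := pow_le_pow_of_le_one hs.1.le hs.2.le (Nat.le_succ m)
    simpa using this

lemma finite_of_offDiag_finite {β : Type*} {S : Set β} (h : S.offDiag.Finite) : S.Finite := by
  by_contra hS
  obtain ⟨a, ha⟩ := Set.Infinite.nonempty hS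
  have hinf : (S \ {a}).Infinite := Set.Infinite.sdiff hS (finite_singleton a)
  refine hinf ((h.preimage (Prod.mk_right_injective a).injOn).subset ?_)
  rintro c ⟨hc, hca⟩
  exact ⟨ha, hc, fun h => hca h.symm⟩

variable {x : ℕ}

/-- The beta integral of `lintegral_weight_numPairs` replaces the denominator `z(z-1)` of the
uniform pick. By `hE`, an outcome without a pair never contributes to `E`, since its condition on
the size would make a pick possible. -/
lemma toOuterMeasure_pickLaw (t : ℝ) (ω : Tree x) (E : Set (Tree x × Option (Ind x × Ind x)))
    (hE : (ω, none) ∈ E → 2 ≤ Z t ω ∧ Z t ω < ⊤) :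
    (pickLaw t ω).toOuterMeasure {c | (ω, c) ∈ E} =
      ∫⁻ s in Ioo (0 : ℝ) 1, ENNReal.ofReal ((1 - s) / s ^ 2) *
        (({p | p ∈ (alive ω t).offDiag ∧ (ω, some p) ∈ E}.encard : ℝ≥0∞) *
          weight s (Z t ω)) := by
  classical
  by_cases h : (alive ω t).offDiag.Finite ∧ (alive ω t).offDiag.Nonempty
  · have hfin := finite_of_offDiag_finite h.1
    obtain ⟨n, hn⟩ : ∃ n : ℕ, Z t ω = n := ⟨_, (hfin.cast_ncard_eq).symm⟩
    have hn2 : 2 ≤ n := by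
      have := one_lt_encard_iff_nontrivial.2 (offDiag_nonempty.1 h.2)
      rw [show (alive ω t).encard = n from hn] at this
      exact_mod_cast this
    obtain ⟨m, rfl⟩ := Nat.exists_eq_add_of_le' hn2
    set N := {p | p ∈ (alive ω t).offDiag ∧ (ω, some p) ∈ E} with hN
    have hcard : (h.1.toFinset.card : ℝ≥0∞) = ((m + 2) * (m + 1) : ℕ) := by
      have h1 := encard_offDiag hfin
      rw [show (alive ω t).encard = _ from hn, h.1.encard_eq_coe_toFinset_card, numPairs] at h1
      have h2 : h.1.toFinset.card = (m + 2) * (m + 1) := by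
        have : ((m + 2 : ℕ) : ℕ∞) - 1 = (m + 1 : ℕ) := by
          rw [← Nat.cast_one, ← ENat.natCast_sub]
          rfl
        rw [this] at h1
        exact_mod_cast h1
      rw [h2]
    have hNcard : ((h.1.toFinset.filter (· ∈ some ⁻¹' {c | (ω, c) ∈ E})).card : ℝ≥0∞) = N.encard := by
      rw [← ENat.toENNReal_coe, ← encard_coe_eq_coe_finsetCard]
      congr 2
      ext p
      simp [hN]
    rw [pickLaw, dif_pos h, PMF.toOuterMeasure_map_apply, PMF.toOuterMeasure_uniformOfFinset_apply,
      hcard, hNcard, hn]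
    simp only [weight_coe, mul_left_comm _ (N.encard : ℝ≥0∞)]
    rw [lintegral_const_mul _ (by fun_prop), lintegral_weight_numPairs, div_eq_mul_inv]
  · rw [pickLaw, dif_neg h, PMF.toOuterMeasure_pure_apply, if_neg]
    · symm
      refine lintegral_eq_zero_of_ae_eq_zero (Filter.Eventually.of_forall fun s => ?_)
      rcases (alive ω t).finite_or_infinite with hfin | hinf
      · have : (alive ω t).offDiag = ∅ := by
          rw [← not_nonempty_iff_eq_empty]
          exact fun h' => h ⟨hfin.offDiag, h'⟩
        simp [this]
      · rw [Z, hinf.encard_eq]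
        simp
    · intro hmem
      obtain ⟨h2, h3⟩ := hE hmem
      have hfin : (alive ω t).Finite := encard_lt_top_iff.1 h3
      refine h ⟨hfin.offDiag, offDiag_nonempty.2 (one_lt_encard_iff_nontrivial.1 ?_)⟩
      exact lt_of_lt_of_le (by norm_num) h2

/-- Tonelli exchanges the genealogy and `s`. The event need only match `S` when the population is
finite, the weight being zero otherwise. -/
lemma prob_eq (t : ℝ) (E : Set (Tree x × Option (Ind x × Ind x)))
    (hE : ∀ ω, (ω, none) ∈ E → 2 ≤ Z t ω ∧ Z t ω < ⊤) {S : Tree x → Set (Ind x × Ind x)}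
    (hS : Measurable fun ω => ((S ω).encard : ℝ≥0∞))
    (hES : ∀ᵐ ω ∂law μ x, Z t ω < ⊤ → {p | p ∈ (alive ω t).offDiag ∧ (ω, some p) ∈ E} = S ω) :
    prob μ x t E = ∫⁻ s in Ioo (0 : ℝ) 1, ENNReal.ofReal ((1 - s) / s ^ 2) *
      ∫⁻ ω, ((S ω).encard : ℝ≥0∞) * weight s (Z t ω) ∂law μ x := by
  have h1 : prob μ x t E = ∫⁻ ω, (∫⁻ s in Ioo (0 : ℝ) 1, ENNReal.ofReal ((1 - s) / s ^ 2) *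
      (((S ω).encard : ℝ≥0∞) * weight s (Z t ω))) ∂law μ x := by
    refine lintegral_congr_ae ?_
    filter_upwards [hES] with ω hω
    rw [toOuterMeasure_pickLaw t ω E (hE ω)]
    by_cases h : Z t ω = ⊤
    · simp [h]
    · rw [hω (lt_top_iff_ne_top.2 h)]
  have hw : Measurable fun p : Tree x × ℝ => weight p.2 (Z t p.1) := by
    have : Measurable fun q : ℝ × ℕ∞ => weight q.1 q.2 := by
      refine measurable_from_prod_countable_left fun z => ?_
      by_cases h : z = ⊤
      · simp [h]
      · simp only [weight, h, if_false]
        exact ENNReal.measurable_ofReal.comp (by fun_prop)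
    exact this.comp (measurable_snd.prodMk ((measurable_Z t).comp measurable_fst))
  rw [h1, lintegral_lintegral_swap]
  · refine lintegral_congr fun s => ?_
    rw [lintegral_const_mul' _ _ ENNReal.ofReal_ne_top]
  · refine Measurable.aemeasurable ?_
    refine Measurable.mul ?_ ((hS.comp measurable_fst).mul hw)
    exact ENNReal.measurable_ofReal.comp (by fun_prop)

lemma prob_ne_top (x : ℕ) (t : ℝ) (E : Set (Tree x × Option (Ind x × Ind x))) :
    prob μ x t E ≠ ⊤ := by
  refine ne_top_of_le_ne_top ENNReal.one_ne_top ?_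
  calc prob μ x t E ≤ ∫⁻ _, 1 ∂law μ x := by
        refine lintegral_mono fun ω => ?_
        rw [PMF.toOuterMeasure_apply, ← (pickLaw t ω).tsum_coe]
        exact ENNReal.tsum_le_tsum fun c => indicator_le_self _ _ _
    _ = 1 := by simp

/-- The integrand in the law of the coalescence time. -/
noncomputable def coalIntegrand (b t : ℝ) (m : ℕ) (s : ℝ) : ℝ :=
  (1 - s) * (deriv (deriv (psi μ b)) s / deriv (psi μ b) s) * deriv (psi μ t) s * psi μ t s ^ m

/-- The integrand in the probability that the picked pair has no common ancestor. -/
noncomputable def foreignIntegrand (t : ℝ) (m : ℕ) (s : ℝ) : ℝ :=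
  (1 - s) * deriv (psi μ t) s ^ 2 * psi μ t s ^ m

lemma prob_coal_eq (x : ℕ) {b t : ℝ} (hb : 0 < b) (ht : b ≤ t) :
    prob μ x t {z | T t z.1 z.2 ≤ (b : EReal)} =
      ∫⁻ s in Ioo (0 : ℝ) 1, ENNReal.ofReal (x * coalIntegrand μ b t (x - 1) s) := by
  rw [prob_eq μ t _ ?_ (S := fun ω => pairs (t - b) t ω) (measurable_encard_pairs_at b t)]
  · refine setLIntegral_congr_fun measurableSet_Ioo fun s hs => ?_
    have hs' : s ∈ Ico (0 : ℝ) 1 := ⟨hs.1.le, hs.2⟩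
    have hs'' : s ∈ Icc (0 : ℝ) 1 := ⟨hs.1.le, hs.2.le⟩
    have hs0 : s ≠ 0 := hs.1.ne'
    rw [lintegral_pairs_mul_weight μ hs.1.le, ← ENNReal.ofReal_toReal (meanPairs_ne_top μ hs' b t),
      ← ENNReal.ofReal_toReal (egf_ne_top μ t hs''), ← psi_eq μ hs.1.le,
      ← ENNReal.ofReal_pow (psi_mem_Icc μ t hs'').1, ← ENNReal.ofReal_natCast,
      ← ENNReal.ofReal_mul (Nat.cast_nonneg x),
      ← ENNReal.ofReal_mul (mul_nonneg (Nat.cast_nonneg x) (pow_nonneg (psi_mem_Icc μ t hs'').1 _)),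
      ← ENNReal.ofReal_mul (div_nonneg (by linarith [hs.2]) (by positivity))]
    congr 1
    have h1 := meanPairs_mul_meanZ μ hs' hb.le ht
    have h2 := meanZ_toReal_pos μ hs hb.le
    rw [← mul_deriv_psi μ b hs, ← mul_deriv_psi μ t hs, ← sq_mul_deriv_deriv_psi μ b hs] at h1
    rw [← mul_deriv_psi μ b hs] at h2
    -- The exponential formula for `𝔼_1(Z_b s^{Z_b})` makes the denominator of the integrand
    -- positive on `(0, 1)`.
    have h3 : deriv (psi μ b) s ≠ 0 := (right_ne_zero_of_mul h2.ne')
    have h4 : (meanPairs μ b t s).toReal =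
        s ^ 2 * deriv (deriv (psi μ b)) s * deriv (psi μ t) s / deriv (psi μ b) s := by
      rw [eq_div_iff h3]
      refine mul_left_cancel₀ hs0 ?_
      linear_combination h1
    rw [h4, coalIntegrand]
    field_simp
  · filter_upwards [ae_good μ x, ae_birth_ne μ x (t - b)] with ω h1 h2 _
    ext p
    refine and_congr_right fun hp => ?_
    exact pairCoalTime_le_iff h1 hb ht h2 hp.1
  · intro ω hω
    exact absurd hω (not_le.2 (EReal.coe_lt_top b))

lemma measurable_encard_foreignPairs (t : ℝ) :
    Measurable fun ω : Tree x => ((foreignPairs t ω).encard : ℝ≥0∞) := by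
  refine (Measurable.of_discrete (f := fun z : ℕ∞ => (z : ℝ≥0∞))).comp (measurable_encard fun q => ?_)
  exact (measurable_prodMk_left (x := t) (measurableSet_offDiag_alive q)).inter
    (MeasurableSet.const _)

lemma prob_foreign_eq (x : ℕ) {t : ℝ} (ht : 0 < t) :
    prob μ x t {z | 2 ≤ Z t z.1 ∧ Z t z.1 < ⊤ ∧ T t z.1 z.2 = ⊤} =
      ∫⁻ s in Ioo (0 : ℝ) 1,
        ENNReal.ofReal (x * ((x : ℝ) - 1) * foreignIntegrand μ t (x - 2) s) := by
  rw [prob_eq μ t _ ?_ (S := fun ω => foreignPairs t ω) (measurable_encard_foreignPairs t)]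
  · refine setLIntegral_congr_fun measurableSet_Ioo fun s hs => ?_
    have hs' : s ∈ Ico (0 : ℝ) 1 := ⟨hs.1.le, hs.2⟩
    have hs'' : s ∈ Icc (0 : ℝ) 1 := ⟨hs.1.le, hs.2.le⟩
    have hs0 : s ≠ 0 := hs.1.ne'
    have hψ := (psi_mem_Icc μ t hs'').1
    have hx : (x : ℝ) * ((x - 1 : ℕ) : ℝ) = x * ((x : ℝ) - 1) := by
      rcases x with _ | x <;> simp
    rw [lintegral_foreignPairs μ hs.1.le, ← meanZ, ← ENNReal.ofReal_toReal (meanZ_ne_top μ hs' t),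
      ← ENNReal.ofReal_toReal (egf_ne_top μ t hs''), ← psi_eq μ hs.1.le,
      ← ENNReal.ofReal_pow hψ, ← ENNReal.ofReal_pow ENNReal.toReal_nonneg,
      ← ENNReal.ofReal_natCast, ← ENNReal.ofReal_natCast,
      ← ENNReal.ofReal_mul (Nat.cast_nonneg x), ← ENNReal.ofReal_mul (by positivity),
      ← ENNReal.ofReal_mul (by positivity),
      ← ENNReal.ofReal_mul (div_nonneg (by linarith [hs.2]) (by positivity))]
    congr 1
    rw [← mul_deriv_psi μ t hs, hx, foreignIntegrand]
    field_simp
  · filter_upwards [ae_good μ x] with ω h1 hZ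
    ext p
    refine and_congr_right fun hp => ?_
    have h2 : 2 ≤ Z t ω := by
      have := one_lt_encard_iff_nontrivial.2 (offDiag_nonempty.1 ⟨p, hp⟩)
      have := Order.add_one_le_of_lt this
      rwa [one_add_one_eq_two] at this
    rw [← pairCoalTime_eq_top_iff h1 ht]
    exact ⟨fun h => h.2.2, fun h => ⟨h2, hZ, h⟩⟩
  · intro ω hω
    exact ⟨hω.1, hω.2.1⟩

/-! ### Convergence of the integrals and passage to real values -/

lemma integral_of_lintegral_ofReal {f : ℝ → ℝ} {a : ℝ} {P : ℝ≥0∞}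
    (hf : AEStronglyMeasurable f (volume.restrict (Ioo 0 1))) (ha : 0 ≤ a)
    (h0 : ∀ s ∈ Ioo (0 : ℝ) 1, 0 ≤ f s)
    (hP : P = ∫⁻ s in Ioo (0 : ℝ) 1, ENNReal.ofReal (a * f s)) :
    (P ≠ ⊤ → 0 < a → IntervalIntegrable f volume 0 1) ∧ P.toReal = a * ∫ s in (0 : ℝ)..1, f s := by
  have h0' : 0 ≤ᵐ[volume.restrict (Ioo 0 1)] fun s => a * f s :=
    (ae_restrict_mem measurableSet_Ioo).mono fun s hs => mul_nonneg ha (h0 s hs)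
  constructor
  · intro hfin hpos
    rw [intervalIntegrable_iff_integrableOn_Ioo_of_le zero_le_one]
    have h1 : IntegrableOn (fun s => a * f s) (Ioo 0 1) := by
      refine (lintegral_ofReal_ne_top_iff_integrable (hf.const_mul a) h0').1 ?_
      rwa [← hP]
    have h2 : IntegrableOn (fun s => a⁻¹ * (a * f s)) (Ioo 0 1) := h1.const_mul a⁻¹
    simpa only [inv_mul_cancel_left₀ hpos.ne'] using h2
  · rw [hP, ← integral_eq_lintegral_of_nonneg_ae h0' (hf.const_mul a), integral_const_mul,
      intervalIntegral.integral_of_le zero_le_one, integral_Ioc_eq_integral_Ioo]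

lemma aestronglyMeasurable_coalIntegrand (b t : ℝ) (m : ℕ) :
    AEStronglyMeasurable (coalIntegrand μ b t m) (volume.restrict (Ioo 0 1)) := by
  have h1 : Measurable fun s => (1 - s) * (deriv (deriv (psi μ b)) s / deriv (psi μ b) s) *
      deriv (psi μ t) s :=
    (Measurable.mul (by fun_prop) ((measurable_deriv _).div (measurable_deriv _))).mul
      (measurable_deriv _)
  exact h1.aestronglyMeasurable.mul
    (((continuousOn_psi μ t).aestronglyMeasurable measurableSet_Ioo).pow m)

lemma aestronglyMeasurable_foreignIntegrand (t : ℝ) (m : ℕ) :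
    AEStronglyMeasurable (foreignIntegrand μ t m) (volume.restrict (Ioo 0 1)) := by
  have h1 : Measurable fun s => (1 - s) * deriv (psi μ t) s ^ 2 :=
    Measurable.mul (by fun_prop) ((measurable_deriv _).pow_const 2)
  exact h1.aestronglyMeasurable.mul
    (((continuousOn_psi μ t).aestronglyMeasurable measurableSet_Ioo).pow m)

lemma deriv_psi_nonneg (t : ℝ) {s : ℝ} (hs : s ∈ Ioo (0 : ℝ) 1) : 0 ≤ deriv (psi μ t) s := by
  have h : 0 ≤ s * deriv (psi μ t) s := by
    rw [mul_deriv_psi μ t hs]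
    exact ENNReal.toReal_nonneg
  exact nonneg_of_mul_nonneg_right h hs.1

lemma deriv_deriv_psi_nonneg (t : ℝ) {s : ℝ} (hs : s ∈ Ioo (0 : ℝ) 1) :
    0 ≤ deriv (deriv (psi μ t)) s := by
  have h : 0 ≤ s ^ 2 * deriv (deriv (psi μ t)) s := by
    rw [sq_mul_deriv_deriv_psi μ t hs]
    exact ENNReal.toReal_nonneg
  exact nonneg_of_mul_nonneg_right h (pow_pos hs.1 2)

lemma coalIntegrand_nonneg (b t : ℝ) (m : ℕ) {s : ℝ} (hs : s ∈ Ioo (0 : ℝ) 1) :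
    0 ≤ coalIntegrand μ b t m s :=
  mul_nonneg (mul_nonneg (mul_nonneg (by linarith [hs.2])
    (div_nonneg (deriv_deriv_psi_nonneg μ b hs) (deriv_psi_nonneg μ b hs)))
    (deriv_psi_nonneg μ t hs)) (pow_nonneg (psi_mem_Icc μ t ⟨hs.1.le, hs.2.le⟩).1 m)

lemma foreignIntegrand_nonneg (t : ℝ) (m : ℕ) {s : ℝ} (hs : s ∈ Ioo (0 : ℝ) 1) :
    0 ≤ foreignIntegrand μ t m s :=
  mul_nonneg (mul_nonneg (by linarith [hs.2]) (sq_nonneg _))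
    (pow_nonneg (psi_mem_Icc μ t ⟨hs.1.le, hs.2.le⟩).1 m)

/-- With `m + 1` founders, a positive multiple of this nonnegative integrand integrates to a
probability. All exponents are thus covered, including the one read off at `x = 0`. -/
lemma intervalIntegrable_coalIntegrand {b t : ℝ} (hb : 0 < b) (ht : b ≤ t) (m : ℕ) :
    IntervalIntegrable (coalIntegrand μ b t m) volume 0 1 :=
  (integral_of_lintegral_ofReal (aestronglyMeasurable_coalIntegrand μ b t m)
    (Nat.cast_nonneg (m + 1)) (fun _ hs => coalIntegrand_nonneg μ b t m hs)
    (prob_coal_eq μ (m + 1) hb ht)).1 (prob_ne_top μ _ _ _) (by positivity)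

lemma intervalIntegrable_foreignIntegrand {t : ℝ} (ht : 0 < t) (m : ℕ) :
    IntervalIntegrable (foreignIntegrand μ t m) volume 0 1 := by
  have ha : (0 : ℝ) < ((m + 2 : ℕ) : ℝ) * (((m + 2 : ℕ) : ℝ) - 1) := by
    push_cast
    exact mul_pos (by positivity) (by linarith [Nat.cast_nonneg (α := ℝ) m])
  exact (integral_of_lintegral_ofReal (aestronglyMeasurable_foreignIntegrand μ t m)
    ha.le (fun _ hs => foreignIntegrand_nonneg μ t m hs)
    (prob_foreign_eq μ (m + 2) ht)).1 (prob_ne_top μ _ _ _) ha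

end

end BGW

theorem corollary1 (μ : Measure ℕ) [IsFiniteMeasure μ] [NeZero μ]
    (hμ1 : μ {1} = 0) (hμ0 : 0 < μ {0}) :
    -- `E_x(s^{Z_t}) = psi_t(s)^x`, where `psi` solves the differential equation given by `Phi`
    ((∀ (x : ℕ) (t s : ℝ), 0 ≤ t → s ∈ Icc (0 : ℝ) 1 →
        BGW.genFun μ x t s = BGW.psi μ t s ^ x) ∧
      ∀ s ∈ Icc (0 : ℝ) 1, BGW.psi μ 0 s = s ∧
        ∀ t : ℝ, 0 ≤ t →
          HasDerivWithinAt (fun r => BGW.psi μ r s) (BGW.Phi μ (BGW.psi μ t s)) (Ici 0) t) ∧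
    -- the law of the coalescence time
    (∀ (x : ℕ) (t₁ t : ℝ), 0 < t₁ → t₁ ≤ t →
      IntervalIntegrable (fun s : ℝ => (1 - s) *
          (deriv (deriv (BGW.psi μ t₁)) s / deriv (BGW.psi μ t₁) s) *
          deriv (BGW.psi μ t) s * BGW.psi μ t s ^ (x - 1)) volume 0 1 ∧
      (BGW.prob μ x t {z | BGW.T t z.1 z.2 ≤ (t₁ : EReal)}).toReal =
        x * ∫ s in (0 : ℝ)..1, (1 - s) *
          (deriv (deriv (BGW.psi μ t₁)) s / deriv (BGW.psi μ t₁) s) *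
          deriv (BGW.psi μ t) s * BGW.psi μ t s ^ (x - 1)) ∧
    -- the probability that there are two extant individuals or more, and that the picked pair
    -- has no common ancestor
    (∀ (x : ℕ) (t : ℝ), 0 < t →
      IntervalIntegrable (fun s : ℝ => (1 - s) *
          deriv (BGW.psi μ t) s ^ 2 * BGW.psi μ t s ^ (x - 2)) volume 0 1 ∧
      (BGW.prob μ x t {z | 2 ≤ BGW.Z t z.1 ∧ BGW.Z t z.1 < ⊤ ∧ BGW.T t z.1 z.2 = ⊤}).toReal =
        x * ((x : ℝ) - 1) * ∫ s in (0 : ℝ)..1, (1 - s) *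
          deriv (BGW.psi μ t) s ^ 2 * BGW.psi μ t s ^ (x - 2)) := by
  refine ⟨⟨fun x t s _ hs => BGW.genFun_eq_pow μ hs.1 x t, fun s hs => ⟨BGW.psi_zero μ hs,
    fun t ht => BGW.hasDerivWithinAt_psi_left μ hs ht⟩⟩, fun x b t hb ht =>
    ⟨BGW.intervalIntegrable_coalIntegrand μ hb ht (x - 1), ?_⟩, fun x t ht =>
    ⟨BGW.intervalIntegrable_foreignIntegrand μ ht (x - 2), ?_⟩⟩
  · exact (BGW.integral_of_lintegral_ofReal
      (BGW.aestronglyMeasurable_coalIntegrand μ b t (x - 1)) (Nat.cast_nonneg x)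
      (fun _ hs => BGW.coalIntegrand_nonneg μ b t (x - 1) hs) (BGW.prob_coal_eq μ x hb ht)).2
  · have ha : (0 : ℝ) ≤ x * ((x : ℝ) - 1) := by
      rcases x with _ | x
      · simp
      · push_cast
        simp only [add_sub_cancel_right]
        positivity
    exact (BGW.integral_of_lintegral_ofReal
      (BGW.aestronglyMeasurable_foreignIntegrand μ t (x - 2)) ha
      (fun _ hs => BGW.foreignIntegrand_nonneg μ t (x - 2) hs) (BGW.prob_foreign_eq μ x ht)).2
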